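/- Let $X,Y$ (questions) and $A,B$ (answers) be finite non-empty sets and let $\mathcal G$ be a bipartite nonlocal game given by a probability distribution $\mu$ on $X\times Y$ and a predicate $V$; put $\beta_{abxy}=\mu(x,y)V(a,b,x,y)$ (with $V\in\{0,1\}$). For a real table $p=(p(ab|xy))$ its score is $\sum_{a,b,x,y}\beta_{abxy}\,p(ab|xy)$. **Strategies.** $p$ arises from a *sequential operationally-non-signaling strategy* if there are unital $C^*$-algebras $\mathcal A,\mathcal B$, a state $\sigma$ on $\mathcal A$, POVMs $\{f_{b|y}\}_b$ in $\mathcal B$ and completely positive maps $\mathsf T_{a|x}:\mathcal B\to\mathcal A$ such that $\sum_a\mathsf T_{a|x}$ is unital and independent of $x$, and $p(ab|xy)=\sigma(\mathsf T_{a|x}(f_{b|y}))$. It arises from a *commuting operator strategy* if there are a Hilbert space, a density operator $\rho$ and POVMs $\{M_{a|x}\}_a$, $\{N_{b|y}\}_b$ on it with $[M_{a|x},N_{b|y}]=0$ and $p(ab|xy)=\mathrm{Tr}(M_{a|x}N_{b|y}\,\rho)$. Let $\omega_{\mathrm{qc}}(\mathcal G)$ be the supremum of the scores of all $p$ that arise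 from commuting operator strategies. **Hierarchy.** Let $\mathcal A_B$ be the universal unital $C^*$-algebra generated by $f_{b|y}$ with $f_{b|y}^*=f_{b|y}$, $f_{b|y}f_{b'|y}=\delta_{bb'}f_{b|y}$, $\sum_bf_{b|y}=1$. Let $\mathcal A_{AB}$ be the universal unital $C^*$-algebra generated by $f_{ab|xy}$ with $f_{ab|xy}^*=f_{ab|xy}$, $f_{ab|xy}f_{a'b'|xy}=\delta_{aa'}\delta_{bb'}f_{ab|xy}$, $\sum_bf_{ab|xy}=\sum_bf_{ab|xy'}$, $\sum_{a,b}f_{ab|xy}=1$. Let $T_{a|x}:\mathcal A_B\to\mathcal A_{AB}$ be the (non-unital) $*$-homomorphism with $T_{a|x}(f_{b|y})=f_{ab|xy}$. Let $\mathcal W^n_B\subset\mathcal A_B$ and $\mathcal W^n_{AB}\subset\mathcal A_{AB}$ be the sets of products of at most $n$ generators, and $\deg w$ the least number of generators of which $w$ is a product. For $n\ge1$, a complex matrix $\Gamma^{(n)}$ indexed by $\mathcal W^n_{AB}$ is *feasible at level $n$* if * $\Gamma^{(n)}\succeq0$, $\Gamma^{(n)}_{1,1}=1$, and $\Gamma^{(n)}_{w,v}=\Gamma^{(n)}_{w',v'}$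 whenever $w^*v=w'^*v'$ in $\mathcal A_{AB}$; * there is a linear functional $L^{2n}$ on $\mathrm{span}(\mathcal W^{2n}_{AB})\subset\mathcal A_{AB}$ with $L^{2n}(w^*v)=\Gamma^{(n)}_{w,v}$ for all $w,v\in\mathcal W^n_{AB}$, and $$L^{2n}\Bigl(w^*\sum_a\bigl(T_{a|x}(r^*s)-T_{a|x'}(r^*s)\bigr)v\Bigr)=0$$ for all $x,x'\in X$, $w,v\in\mathcal W^n_{AB}$, $r,s\in\mathcal W^n_B$ with $\deg w+\deg v+\deg r+\deg s\le2n$. Let $\omega^{(n)}(\mathcal G)$ be the maximum of $\sum_{a,b,x,y}\beta_{abxy}\Gamma^{(n)}_{1,f_{ab|xy}}$ over all $\Gamma^{(n)}$ that are feasible at level $n$. **Theorem.** For every $p$ the following are equivalent: 1. $p$ arises from a bipartite sequential operationally-non-signaling strategy; 2. $p$ arises from a bipartite commuting operator strategy; 3. there is a family $(\Gamma^{(n)})_{n\ge1}$, with $\Gamma^{(n)}$ feasible at level $n$, such that $p(ab|xy)=\Gamma^{(n)}_{1,f_{ab|xy}}$ for all $a,b,x,y$ and all $n\ge1$. Moreover,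 for every $n\ge1$ the maximum $\omega^{(n)}(\mathcal G)$ is attained, the set of scores of the $p$ that arise from commuting operator strategies has the (finite) least upper bound $\omega_{\mathrm{qc}}(\mathcal G)$, the sequence $(\omega^{(n)}(\mathcal G))_{n\ge1}$ is non-increasing, and $\omega^{(n)}(\mathcal G)\to\omega_{\mathrm{qc}}(\mathcal G)$ as $n\to\infty$. -/

import Mathlib

namespace SeqNPA

open scoped ENNReal ComplexOrder CStarAlgebra

noncomputable section

/-! ## Games, correlations, scores -/

/-- A bipartite nonlocal game with question sets `X`, `Y` and answer sets `A`, `B`: a probability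
distribution `μ` on the pairs of questions and a predicate `V`. -/
structure NonlocalGame (X Y A B : Type) [Fintype X] [Fintype Y] where
  μ : X → Y → ℝ
  μ_nonneg : ∀ x y, 0 ≤ μ x y
  μ_sum : ∑ x, ∑ y, μ x y = 1
  V : A → B → X → Y → Bool

/-- A table of numbers; `p a b x y` stands for `p(ab|xy)`. -/
abbrev Correlation (X Y A B : Type) : Type := A → B → X → Y → ℝ

namespace NonlocalGame

variable {X Y A B : Type} [Fintype X] [Fintype Y] (G : NonlocalGame X Y A B)

/-- The payoff tensor `β_{abxy} = μ(x, y) V(a, b, x, y)`. -/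
def payoff (a : A) (b : B) (x : X) (y : Y) : ℝ := if G.V a b x y then G.μ x y else 0

/-- The score `∑ β_{abxy} p(ab|xy)` of a correlation. -/
def score [Fintype A] [Fintype B] (p : Correlation X Y A B) : ℝ :=
  ∑ a, ∑ b, ∑ x, ∑ y, G.payoff a b x y * p a b x y

end NonlocalGame

/-! ## Sequential operationally-non-signaling strategies -/

/-- `p` arises from a sequential operationally-non-signaling strategy (Heisenberg picture):
Bob's observables form a unital C⋆-algebra `𝓑`, the observables of the system that Alice receives
form a unital C⋆-algebra `𝓐` with a state `σ`; Alice's instruments are families of completely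
positive maps `T x a : 𝓑 → 𝓐` whose sum over the outcome `a` is unital and does not depend on the
question `x`; Bob performs the POVMs `f y`, and `p(ab|xy) = σ (T_{a|x} (f_{b|y}))`. -/
def IsSequentialONS {X Y A B : Type} [Fintype A] [Fintype B] (p : Correlation X Y A B) : Prop :=
  ∃ (𝓐 : Type) (_ : CStarAlgebra 𝓐) (_ : PartialOrder 𝓐) (_ : StarOrderedRing 𝓐)
    (𝓑 : Type) (_ : CStarAlgebra 𝓑) (_ : PartialOrder 𝓑) (_ : StarOrderedRing 𝓑)
    (σ : 𝓐 →ₚ[ℂ] ℂ) (T : X → A → 𝓑 →CP 𝓐) (f : Y → B → 𝓑),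
    σ 1 = 1 ∧
    (∀ x, ∑ a, T x a 1 = 1) ∧
    (∀ x x' s, ∑ a, T x a s = ∑ a, T x' a s) ∧
    (∀ y b, 0 ≤ f y b) ∧
    (∀ y, ∑ b, f y b = 1) ∧
    ∀ a b x y, (p a b x y : ℂ) = σ (T x a (f y b))

/-! ## Commuting operator strategies -/

section Hilbert

variable {H : Type} [NormedAddCommGroup H] [InnerProductSpace ℂ H]

/-- The operator `S` has trace `t`: in every orthonormal basis `e` the series `∑ ⟨e i, S (e i)⟩`
converges (unconditionally) to `t`. -/
def HasTrace (S : H →L[ℂ] H) (t : ℂ) : Prop :=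
  ∀ (ι : Type) (e : HilbertBasis ι ℂ H), HasSum (fun i => inner ℂ (e i) (S (e i))) t

/-- Density operators: positive operators of trace one. -/
def IsDensityOperator (ρ : H →L[ℂ] H) : Prop := ρ.IsPositive ∧ HasTrace ρ 1

end Hilbert

/-- `p` arises from a commuting operator strategy: a Hilbert space with a density operator `ρ`, and
POVMs `M x` (Alice), `N y` (Bob) on it, such that Alice's operators commute with Bob's and
`p(ab|xy) = Tr(M_{a|x} N_{b|y} ρ)`. -/
def IsCommutingOperator {X Y A B : Type} [Fintype A] [Fintype B] (p : Correlation X Y A B) :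
    Prop :=
  ∃ (H : Type) (_ : NormedAddCommGroup H) (_ : InnerProductSpace ℂ H) (_ : CompleteSpace H)
    (ρ : H →L[ℂ] H) (M : X → A → H →L[ℂ] H) (N : Y → B → H →L[ℂ] H),
    IsDensityOperator ρ ∧
    (∀ x a, (M x a).IsPositive) ∧ (∀ x, ∑ a, M x a = 1) ∧
    (∀ y b, (N y b).IsPositive) ∧ (∀ y, ∑ b, N y b = 1) ∧
    (∀ x a y b, M x a * N y b = N y b * M x a) ∧
    ∀ a b x y, HasTrace (M x a * N y b * ρ) (p a b x y : ℂ)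

/-- The commuting-operator value of a game. -/
def NonlocalGame.commutingValue {X Y A B : Type} [Fintype X] [Fintype Y] [Fintype A] [Fintype B]
    (G : NonlocalGame X Y A B) : ℝ :=
  sSup (G.score '' {p | IsCommutingOperator p})

/-! ## Universal C⋆-algebras of projections -/

/-- Relations for a family of generators indexed by `I`, under which all generators are
(self-adjoint) projections. -/
structure Relations (I : Type) where
  Holds : ∀ (D : Type) [CStarAlgebra D], (I → D) → Prop
  isStarProjection : ∀ (D : Type) [CStarAlgebra D] (f : I → D), Holds D f →
    ∀ i, IsStarProjection (f i)

/-- A nonzero unital C⋆-algebra with a family of elements satisfying the relations `ℛ`. -/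
structure Model {I : Type} (ℛ : Relations I) where
  D : Type
  [cstar : CStarAlgebra D]
  [nontriv : Nontrivial D]
  gen : I → D
  holds : ℛ.Holds D gen

attribute [instance] Model.cstar Model.nontriv

/-- The C⋆-algebra of bounded families in the product of all models. -/
abbrev Ambient {I : Type} (ℛ : Relations I) : Type 1 := lp (fun m : Model ℛ => m.D) ∞

instance {I : Type} (ℛ : Relations I) : CStarAlgebra (Ambient ℛ) where

/-- The generator `i` as the family of its values in all models. -/
def ambientGen {I : Type} (ℛ : Relations I) (i : I) : Ambient ℛ :=
  ⟨fun m => m.gen i, memℓp_infty ⟨1, by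
    rintro _ ⟨m, rfl⟩
    exact (ℛ.isStarProjection m.D m.gen m.holds i).norm_le⟩⟩

/-- The universal unital C⋆-algebra `C⋆(I | ℛ)`: the C⋆-subalgebra generated by the generators in
the product of all models. Evaluation in a model is the ⋆-homomorphism that sends generators to the
given elements, and the norm is the supremum of the norms in all models. -/
def univSubalgebra {I : Type} (ℛ : Relations I) : StarSubalgebra ℂ (Ambient ℛ) :=
  (StarAlgebra.adjoin ℂ (Set.range (ambientGen ℛ))).topologicalClosure

/-- The universal unital C⋆-algebra `C⋆(I | ℛ)` as a type. -/
abbrev Univ {I : Type} (ℛ : Relations I) : Type 1 := univSubalgebra ℛ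

instance {I : Type} (ℛ : Relations I) : IsClosed (univSubalgebra ℛ : Set (Ambient ℛ)) :=
  StarSubalgebra.isClosed_topologicalClosure _

/-- `C⋆(I | ℛ)` is a C⋆-algebra. -/
instance {I : Type} (ℛ : Relations I) : CStarAlgebra (Univ ℛ) :=
  StarSubalgebra.cstarAlgebra (univSubalgebra ℛ)

theorem ambientGen_mem {I : Type} (ℛ : Relations I) (i : I) :
    ambientGen ℛ i ∈ univSubalgebra ℛ :=
  StarSubalgebra.le_topologicalClosure _ (StarAlgebra.subset_adjoin ℂ _ ⟨i, rfl⟩)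

/-- The generators of the universal C⋆-algebra. -/
def gen {I : Type} (ℛ : Relations I) (i : I) : Univ ℛ := ⟨ambientGen ℛ i, ambientGen_mem ℛ i⟩

/-- Evaluation in a model. -/
def eval {I : Type} {ℛ : Relations I} (m : Model ℛ) : Univ ℛ →⋆ₐ[ℂ] m.D where
  toFun s := s.1 m
  map_one' := rfl
  map_mul' _ _ := rfl
  map_zero' := rfl
  map_add' _ _ := rfl
  commutes' _ := rfl
  map_star' _ := rfl

/-- Universal property: elements of a nonzero unital C⋆-algebra `D` that satisfy the relations are
the images of the generators under a unital ⋆-homomorphism. -/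
theorem exists_lift {I : Type} (ℛ : Relations I) (D : Type) [CStarAlgebra D] [Nontrivial D]
    (f : I → D) (hf : ℛ.Holds D f) : ∃ φ : Univ ℛ →⋆ₐ[ℂ] D, ∀ i, φ (gen ℛ i) = f i :=
  ⟨eval (ℛ := ℛ) { D := D, gen := f, holds := hf }, fun _ => rfl⟩

theorem eval_gen {I : Type} {ℛ : Relations I} (m : Model ℛ) (i : I) :
    eval m (gen ℛ i) = m.gen i := rfl

theorem univ_ext {I : Type} {ℛ : Relations I} {s t : Univ ℛ} (h : ∀ m, eval m s = eval m t) :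
    s = t := Subtype.ext (lp.ext (funext h))

/-- The word set at level `n`: all products of at most `n` generators, as elements of the algebra
(the empty product is `1`). -/
def words {I : Type} (ℛ : Relations I) (n : ℕ) : Set (Univ ℛ) :=
  {w | ∃ l : List I, l.length ≤ n ∧ (l.map (gen ℛ)).prod = w}

/-- The degree of a word: the least number of generators of which it is a product. -/
def deg {I : Type} {ℛ : Relations I} (w : Univ ℛ) : ℕ := sInf {n | w ∈ words ℛ n}

theorem one_mem_words {I : Type} (ℛ : Relations I) (n : ℕ) : (1 : Univ ℛ) ∈ words ℛ n :=
  ⟨[], Nat.zero_le _, rfl⟩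

theorem gen_mem_words {I : Type} (ℛ : Relations I) {n : ℕ} (hn : 1 ≤ n) (i : I) :
    gen ℛ i ∈ words ℛ n :=
  ⟨[i], by simpa using hn, by simp⟩

/-! ## The algebras `𝒜_B`, `𝒜_{AB}` and the ⋆-homomorphisms `T_{a|x}` -/

/-- The relations `ℛ_B`: for every `y` the generators `f_{b|y}` form a PVM. -/
structure HoldsB {Y B : Type} {D : Type*} [Fintype B] [Ring D] [StarRing D] (f : B × Y → D) : Prop where
  star_eq : ∀ b y, star (f (b, y)) = f (b, y)
  mul_self : ∀ b y, f (b, y) * f (b, y) = f (b, y)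
  mul_of_ne : ∀ b b' y, b ≠ b' → f (b, y) * f (b', y) = 0
  sum_eq : ∀ y, ∑ b, f (b, y) = 1

/-- The relations `ℛ_{AB}`: for all `x, y` the generators `f_{ab|xy}` form a PVM, and
`∑_b f_{ab|xy}` does not depend on `y`. -/
structure HoldsAB {X Y A B : Type} {D : Type*} [Fintype A] [Fintype B] [Ring D] [StarRing D]
    (f : A × B × X × Y → D) : Prop where
  star_eq : ∀ a b x y, star (f (a, b, x, y)) = f (a, b, x, y)
  mul_self : ∀ a b x y, f (a, b, x, y) * f (a, b, x, y) = f (a, b, x, y)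
  mul_of_ne : ∀ a b a' b' x y, (a, b) ≠ (a', b') → f (a, b, x, y) * f (a', b', x, y) = 0
  sum_eq_sum : ∀ a x y y', ∑ b, f (a, b, x, y) = ∑ b, f (a, b, x, y')
  sum_eq : ∀ x y, ∑ a, ∑ b, f (a, b, x, y) = 1

/-- The relations `ℛ_B`. -/
def relB (Y B : Type) [Fintype B] : Relations (B × Y) where
  Holds _ _ f := HoldsB f
  isStarProjection _ _ _ h i := ⟨h.mul_self i.1 i.2, h.star_eq i.1 i.2⟩

/-- The relations `ℛ_{AB}`. -/
def relAB (X Y A B : Type) [Fintype A] [Fintype B] : Relations (A × B × X × Y) where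
  Holds _ _ f := HoldsAB f
  isStarProjection _ _ _ h i := ⟨h.mul_self i.1 i.2.1 i.2.2.1 i.2.2.2,
    h.star_eq i.1 i.2.1 i.2.2.1 i.2.2.2⟩

/-- Bob's algebra `𝒜_B`. -/
abbrev AlgB (Y B : Type) [Fintype B] : Type 1 := Univ (relB Y B)

/-- The algebra `𝒜_{AB}` of Bob after Alice's measurement. -/
abbrev AlgAB (X Y A B : Type) [Fintype A] [Fintype B] : Type 1 := Univ (relAB X Y A B)

section Hom

variable {X Y A B : Type} [Fintype A] [Fintype B]

theorem HoldsAB.mul_sum {D : Type*} [Ring D] [StarRing D] {f : A × B × X × Y → D}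
    (h : HoldsAB f) (a : A) (b : B) (x : X) (y y₀ : Y) :
    f (a, b, x, y) * ∑ b', f (a, b', x, y₀) = f (a, b, x, y) := by
  rw [h.sum_eq_sum a x y₀ y, Finset.mul_sum, Finset.sum_eq_single b, h.mul_self]
  · intro b' _ hb
    exact h.mul_of_ne _ _ _ _ _ _ (by simpa using hb.symm)
  · simp

theorem HoldsAB.star_sum {D : Type*} [Ring D] [StarRing D] {f : A × B × X × Y → D}
    (h : HoldsAB f) (a : A) (x : X) (y₀ : Y) :
    star (∑ b', f (a, b', x, y₀)) = ∑ b', f (a, b', x, y₀) := by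
  simp [h.star_eq]

theorem HoldsAB.sum_mul {D : Type*} [Ring D] [StarRing D] {f : A × B × X × Y → D}
    (h : HoldsAB f) (a : A) (b : B) (x : X) (y y₀ : Y) :
    (∑ b', f (a, b', x, y₀)) * f (a, b, x, y) = f (a, b, x, y) := by
  have := congrArg star (h.mul_sum a b x y y₀)
  rwa [star_mul, h.star_sum, h.star_eq] at this

theorem HoldsAB.sum_mul_sum {D : Type*} [Ring D] [StarRing D] {f : A × B × X × Y → D}
    (h : HoldsAB f) (a : A) (x : X) (y₀ : Y) :
    (∑ b', f (a, b', x, y₀)) * (∑ b', f (a, b', x, y₀)) = ∑ b', f (a, b', x, y₀) := by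
  rw [Finset.sum_mul]
  exact Finset.sum_congr rfl fun b _ => h.mul_sum a b x y₀ y₀

open Classical in
/-- The projections `f_{ab|xy}` (`a, x` fixed) sum up to the projection `P = ∑_b f_{ab|xy₀}`; adding
`1 - P` to the one with `b = b₀` turns them into PVMs. -/
def compress {D : Type*} [Ring D] (f : A × B × X × Y → D) (a : A) (x : X) (b₀ : B) (y₀ : Y) :
    B × Y → D :=
  fun i => f (a, i.1, x, i.2) + if i.1 = b₀ then 1 - ∑ b, f (a, b, x, y₀) else 0

theorem compress_holds {D : Type*} [Ring D] [StarRing D] {f : A × B × X × Y → D}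
    (h : HoldsAB f) (a : A) (x : X) (b₀ : B) (y₀ : Y) : HoldsB (compress f a x b₀ y₀) where
  star_eq b y := by
    by_cases hb : b = b₀ <;> simp [compress, hb, h.star_eq]
  mul_self b y := by
    by_cases hb : b = b₀
    · simp [compress, hb, mul_add, add_mul, mul_sub, sub_mul, h.mul_self, h.mul_sum, h.sum_mul,
        h.sum_mul_sum]
    · simp [compress, hb, h.mul_self]
  mul_of_ne b b' y hbb := by
    have h0 : f (a, b, x, y) * f (a, b', x, y) = 0 :=
      h.mul_of_ne _ _ _ _ _ _ (by simpa using hbb)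
    by_cases hb : b = b₀
    · have hb' : b' ≠ b₀ := fun h' => hbb (hb.trans h'.symm)
      rw [hb] at h0
      simp [compress, hb, hb', add_mul, sub_mul, h.sum_mul, h0]
    · by_cases hb' : b' = b₀
      · rw [hb'] at h0
        simp [compress, hb, hb', mul_add, mul_sub, h.mul_sum, h0]
      · simp [compress, hb, hb', h0]
  sum_eq y := by
    classical
    have h1 : ∑ b, compress f a x b₀ y₀ (b, y) = ∑ b, f (a, b, x, y) +
        ∑ b, if b = b₀ then 1 - ∑ b, f (a, b, x, y₀) else 0 := by
      rw [← Finset.sum_add_distrib]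
      exact Finset.sum_congr rfl fun b _ => by by_cases hb : b = b₀ <;> simp [compress, hb]
    rw [h1, Finset.sum_eq_single b₀ (fun b _ hb => if_neg hb) (by simp), if_pos rfl,
      h.sum_eq_sum a x y y₀, add_sub_cancel]

/-- Every model of `ℛ_{AB}` gives a model of `ℛ_B`. -/
def compressModel (a : A) (x : X) (b₀ : B) (y₀ : Y) (m : Model (relAB X Y A B)) :
    Model (relB Y B) where
  D := m.D
  gen := compress m.gen a x b₀ y₀
  holds := compress_holds m.holds a x b₀ y₀

/-- The induced unital ⋆-homomorphism between the products of all models. -/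
def ambientHom (a : A) (x : X) (b₀ : B) (y₀ : Y) :
    Ambient (relB Y B) →⋆ₐ[ℂ] Ambient (relAB X Y A B) where
  toFun s := ⟨fun m => s (compressModel a x b₀ y₀ m), memℓp_infty ⟨‖s‖, by
    rintro _ ⟨m, rfl⟩
    exact lp.norm_apply_le_norm ENNReal.top_ne_zero s _⟩⟩
  map_one' := rfl
  map_mul' _ _ := rfl
  map_zero' := rfl
  map_add' _ _ := rfl
  commutes' _ := rfl
  map_star' _ := rfl

theorem ambientHom_apply (a : A) (x : X) (b₀ : B) (y₀ : Y) (s : Ambient (relB Y B))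
    (m : Model (relAB X Y A B)) :
    ambientHom a x b₀ y₀ s m = s (compressModel a x b₀ y₀ m) := rfl

theorem continuous_ambientHom (a : A) (x : X) (b₀ : B) (y₀ : Y) :
    Continuous (ambientHom (X := X) (A := A) a x b₀ y₀ : Ambient (relB Y B) → _) :=
  AddMonoidHomClass.continuous_of_bound (ambientHom (X := X) (A := A) a x b₀ y₀) 1 fun s => by
    rw [one_mul]
    exact lp.norm_le_of_forall_le (norm_nonneg s) fun m =>
      lp.norm_apply_le_norm ENNReal.top_ne_zero s _

/-- The generators of `𝒜_{AB}` satisfy the relations `ℛ_{AB}`. -/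
theorem gen_holds : HoldsAB (gen (relAB X Y A B)) where
  star_eq a b x y := univ_ext fun m => m.holds.star_eq a b x y
  mul_self a b x y := univ_ext fun m => m.holds.mul_self a b x y
  mul_of_ne a b a' b' x y h := univ_ext fun m => m.holds.mul_of_ne a b a' b' x y h
  sum_eq_sum a x y y' := univ_ext fun m => by
    simpa only [map_sum, eval_gen] using m.holds.sum_eq_sum a x y y'
  sum_eq x y := univ_ext fun m => by
    simpa only [map_sum, eval_gen, map_one] using m.holds.sum_eq x y

/-- The projection `P_{a|x} = ∑_b f_{ab|xy₀}`. -/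
def proj (a : A) (x : X) (y₀ : Y) : AlgAB X Y A B := ∑ b, gen (relAB X Y A B) (a, b, x, y₀)

theorem ambientHom_gen (a : A) (x : X) (b₀ : B) (y₀ : Y) (i : B × Y) :
    ambientHom a x b₀ y₀ (ambientGen (relB Y B) i) =
      ((compress (gen (relAB X Y A B)) a x b₀ y₀ i : AlgAB X Y A B) : Ambient _) := by
  refine lp.ext (funext fun m => ?_)
  change compress m.gen a x b₀ y₀ i = eval m (compress (gen (relAB X Y A B)) a x b₀ y₀ i)
  by_cases hb : i.1 = b₀ <;> simp [compress, hb, eval_gen]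

theorem compress_mul_proj (a : A) (x : X) (b₀ : B) (y₀ : Y) (i : B × Y) :
    compress (gen (relAB X Y A B)) a x b₀ y₀ i * proj a x y₀ =
      gen (relAB X Y A B) (a, i.1, x, i.2) := by
  have h := gen_holds (X := X) (Y := Y) (A := A) (B := B)
  by_cases hb : i.1 = b₀ <;>
    simp [compress, proj, hb, add_mul, sub_mul, h.mul_sum, h.sum_mul_sum]

theorem proj_mul_compress (a : A) (x : X) (b₀ : B) (y₀ : Y) (i : B × Y) :
    proj a x y₀ * compress (gen (relAB X Y A B)) a x b₀ y₀ i =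
      gen (relAB X Y A B) (a, i.1, x, i.2) := by
  have h := gen_holds (X := X) (Y := Y) (A := A) (B := B)
  by_cases hb : i.1 = b₀ <;>
    simp [compress, proj, hb, mul_add, mul_sub, h.sum_mul, h.sum_mul_sum]

theorem star_proj (a : A) (x : X) (y₀ : Y) :
    star (proj a x y₀ : AlgAB X Y A B) = proj a x y₀ := gen_holds.star_sum a x y₀

theorem proj_mul_proj (a : A) (x : X) (y₀ : Y) :
    (proj a x y₀ : AlgAB X Y A B) * proj a x y₀ = proj a x y₀ := gen_holds.sum_mul_sum a x y₀

theorem ambientHom_mem (a : A) (x : X) (b₀ : B) (y₀ : Y) (s : AlgB Y B) :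
    ambientHom (X := X) a x b₀ y₀ s.1 ∈ univSubalgebra (relAB X Y A B) ⊓
      StarSubalgebra.centralizer ℂ {(proj a x y₀ : AlgAB X Y A B).1} := by
  have hle : univSubalgebra (relB Y B) ≤ (univSubalgebra (relAB X Y A B) ⊓
      StarSubalgebra.centralizer ℂ {(proj a x y₀ : AlgAB X Y A B).1}).comap
        (ambientHom (X := X) a x b₀ y₀) := by
    refine StarSubalgebra.topologicalClosure_minimal (StarAlgebra.adjoin_le ?_) ?_
    · rintro _ ⟨i, rfl⟩
      refine (StarSubalgebra.mem_comap _ _ _).2 ?_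
      rw [ambientHom_gen]
      have hc := congrArg Subtype.val ((proj_mul_compress (X := X) a x b₀ y₀ i).trans
        (compress_mul_proj a x b₀ y₀ i).symm)
      refine ⟨Subtype.property _, ?_⟩
      refine (StarSubalgebra.mem_centralizer_iff ℂ).2 ?_
      rintro _ rfl
      have hs := congrArg Subtype.val (star_proj (B := B) a x y₀)
      refine ⟨hc, ?_⟩
      change star (proj a x y₀ : AlgAB X Y A B).1 = _ at hs
      rw [hs]
      exact hc
    · exact (IsClosed.inter (StarSubalgebra.isClosed_topologicalClosure _)
        (Set.isClosed_centralizer _)).preimage (continuous_ambientHom (X := X) a x b₀ y₀)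
  exact hle s.2

/-- The unital ⋆-homomorphism `𝒜_B → 𝒜_{AB}` that sends the generators to the compressed ones. -/
def unitalHom (a : A) (x : X) (b₀ : B) (y₀ : Y) : AlgB Y B →⋆ₐ[ℂ] AlgAB X Y A B where
  toFun s := ⟨ambientHom a x b₀ y₀ s.1, (ambientHom_mem a x b₀ y₀ s).1⟩
  map_one' := rfl
  map_mul' _ _ := rfl
  map_zero' := rfl
  map_add' _ _ := rfl
  commutes' _ := rfl
  map_star' _ := rfl

theorem unitalHom_gen (a : A) (x : X) (b₀ : B) (y₀ : Y) (i : B × Y) :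
    unitalHom (X := X) a x b₀ y₀ (gen (relB Y B) i) =
      compress (gen (relAB X Y A B)) a x b₀ y₀ i :=
  Subtype.ext (ambientHom_gen a x b₀ y₀ i)

theorem commute_proj (a : A) (x : X) (b₀ : B) (y₀ : Y) (s : AlgB Y B) :
    proj a x y₀ * unitalHom (X := X) a x b₀ y₀ s = unitalHom a x b₀ y₀ s * proj a x y₀ :=
  Subtype.ext ((StarSubalgebra.mem_centralizer_iff ℂ).1 (ambientHom_mem a x b₀ y₀ s).2 _ rfl).1

variable [Nonempty B] [Nonempty Y]

/-- The (non-unital) ⋆-homomorphism `T_{a|x} : 𝒜_B → 𝒜_{AB}` with `T_{a|x} f_{b|y} = f_{ab|xy}`. -/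
def T (a : A) (x : X) : AlgB Y B →⋆ₙₐ[ℂ] AlgAB X Y A B where
  toFun s := unitalHom a x (Classical.arbitrary B) (Classical.arbitrary Y) s *
    proj a x (Classical.arbitrary Y)
  map_smul' c s := by simp
  map_zero' := by simp
  map_add' s t := by simp [add_mul]
  map_mul' s t := by
    rw [map_mul, mul_assoc, mul_assoc, ← mul_assoc (proj a x _), commute_proj, mul_assoc,
      proj_mul_proj]
  map_star' s := by
    rw [map_star, star_mul, star_proj, ← map_star, commute_proj]

theorem T_gen (a : A) (x : X) (i : B × Y) :
    T a x (gen (relB Y B) i) = gen (relAB X Y A B) (a, i.1, x, i.2) := by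
  change unitalHom a x _ _ _ * proj a x _ = _
  rw [unitalHom_gen, compress_mul_proj]

/-- The value at the unit is `∑_b f_{ab|xy}`, for any `y`. -/
theorem T_one (a : A) (x : X) (y : Y) :
    T a x (1 : AlgB Y B) = ∑ b, gen (relAB X Y A B) (a, b, x, y) := by
  change unitalHom a x _ _ 1 * proj a x _ = _
  rw [map_one, one_mul]
  exact gen_holds.sum_eq_sum a x _ y

end Hom

/-! ## The hierarchy -/

section Hierarchy

variable {X Y A B : Type} [Fintype A] [Fintype B] [Nonempty B] [Nonempty Y]

/-- Matrices indexed by the words of length at most `n` in the generators `f_{ab|xy}`. -/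
abbrev MomentMatrix (X Y A B : Type) [Fintype A] [Fintype B] (n : ℕ) : Type 1 :=
  Matrix (words (relAB X Y A B) n) (words (relAB X Y A B) n) ℂ

/-- Feasibility at level `n`. Only the values of the linear functional `L` on the span of the words
of length at most `2 n` matter; there `L` is determined by `Γ`. -/
structure IsFeasible (n : ℕ) (Γ : MomentMatrix X Y A B n) : Prop where
  posSemidef : Γ.PosSemidef
  normalized : Γ ⟨1, one_mem_words _ n⟩ ⟨1, one_mem_words _ n⟩ = 1
  hankel : ∀ w v w' v' : words (relAB X Y A B) n,
    star (w : AlgAB X Y A B) * v = star (w' : AlgAB X Y A B) * v' → Γ w v = Γ w' v'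
  nonsignaling : ∃ L : AlgAB X Y A B →ₗ[ℂ] ℂ,
    (∀ w v : words (relAB X Y A B) n, L (star (w : AlgAB X Y A B) * v) = Γ w v) ∧
    ∀ (x x' : X) (w v : words (relAB X Y A B) n) (r s : words (relB Y B) n),
      deg (w : AlgAB X Y A B) + deg (v : AlgAB X Y A B) + deg (r : AlgB Y B) + deg (s : AlgB Y B)
        ≤ 2 * n →
      L (star (w : AlgAB X Y A B) *
        (∑ a, (T a x (star (r : AlgB Y B) * (s : AlgB Y B)) - T a x' (star (r : AlgB Y B) * (s : AlgB Y B)))) * v) = 0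

/-- The entry `Γ_{1, f_{ab|xy}}` of a moment matrix of level `n ≥ 1`. -/
def entry {n : ℕ} (hn : 1 ≤ n) (Γ : MomentMatrix X Y A B n) (a : A) (b : B) (x : X) (y : Y) : ℂ :=
  Γ ⟨1, one_mem_words _ n⟩ ⟨gen _ (a, b, x, y), gen_mem_words _ hn _⟩

/-- There is a family of feasible solutions, one for every level `n ≥ 1`, that all reproduce `p`. -/
def IsRealizedAtAllLevels (p : Correlation X Y A B) : Prop :=
  ∃ Γ : ∀ n, MomentMatrix X Y A B n, ∀ (n : ℕ) (hn : 1 ≤ n),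
    IsFeasible n (Γ n) ∧ ∀ a b x y, (p a b x y : ℂ) = entry hn (Γ n) a b x y

variable [Fintype X] [Fintype Y] (G : NonlocalGame X Y A B)

/-- The scores of the feasible solutions at level `n ≥ 1`. -/
def feasibleScores (n : ℕ) : Set ℝ :=
  {v | ∃ (hn : 1 ≤ n) (Γ : MomentMatrix X Y A B n), IsFeasible n Γ ∧
    (v : ℂ) = ∑ a, ∑ b, ∑ x, ∑ y, (G.payoff a b x y : ℂ) * entry hn Γ a b x y}

/-- The value of the hierarchy at level `n ≥ 1`. -/
def hierarchyValue (n : ℕ) : ℝ := sSup (feasibleScores G n)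

end Hierarchy

end

end SeqNPA

namespace SeqNPA

open scoped ENNReal ComplexOrder CStarAlgebra ComplexConjugate InnerProductSpace

noncomputable section

/-! ## Positive semidefinite sesquilinear forms and their Hilbert spaces -/

/-! The common source of commuting operator strategies is a Radon–Nikodym argument for forms.
Alice's outcomes give positive semidefinite forms `q x a` on one vector space `E`, and their sum
over `a` is a form `h` independent of `x`. On the Hilbert space of `h` each `q x a ≤ h` is
represented by a positive contraction, and these contractions form Alice's POVMs. Bob acts on `E` by
multipliers that are symmetric for every `q x a`, and exactly this symmetry makes his operators
commute with Alice's. This is `isCommutingOperator_of_forms`.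

For a sequential strategy take `E = 𝓑` and the forms `σ(T_{a|x}(r⋆ s))`, with Bob multiplying by
`f_{b|y}` from the left. Conversely, the square roots `S_{a|x}` of Alice's POVM elements define the
completely positive maps `s ↦ S_{a|x} s S_{a|x}` on their commutant, which contains Bob's roots.
There the map is multiplication by `S_{a|x}²`, so its sum over `a` is the inclusion for every `x`.

For the hierarchy, feasible matrices are replaced by functionals (`IsLevel`). A commuting strategy
can be made projective by two Naimark dilations. Then `f_{ab|xy} ↦ P_{a|x} Q_{b|y}` is a model of
the relations, and the state composed with evaluation in it is a functional of every level.
Conversely, a functional `L` of all levels gives the forms `L(T_{a|x}(r⋆ s))`, to which the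
Radon–Nikodym argument applies.

What joins the levels is compactness. Since generators are projections, `|L w| ≤ 1` on words of
length `2 n` (`IsLevel.norm_apply_le`), so functionals have limits along ultrafilters, and a limit
along levels tending to infinity has all levels (`exists_isLevel_limit`). This yields the
equivalence with the hierarchy, attainment of the maximum at each level, and convergence of the
values: limits of maximizers are commuting strategies. -/

/-- A positive semidefinite sesquilinear form. -/
structure PosForm (E : Type*) [AddCommGroup E] [Module ℂ E] where
  form : E →ₗ⋆[ℂ] E →ₗ[ℂ] ℂ
  nonneg : ∀ r, 0 ≤ form r r

/-- Polarization: over `ℂ` positivity already forces hermitian symmetry, because the values at `r +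
s` and `r + i s` are real. -/
theorem PosForm.conj_form {E : Type*} [AddCommGroup E] [Module ℂ E] (q : PosForm E) (r s : E) :
    conj (q.form s r) = q.form r s := by
  have hr := (Complex.nonneg_iff.1 (q.nonneg r)).2
  have hs := (Complex.nonneg_iff.1 (q.nonneg s)).2
  have h1 := (Complex.nonneg_iff.1 (q.nonneg (r + s))).2
  have h2 := (Complex.nonneg_iff.1 (q.nonneg (r + Complex.I • s))).2
  simp only [map_add, LinearMap.add_apply, map_smulₛₗ, LinearMap.smul_apply, Complex.add_im,
    smul_eq_mul, RingHom.id_apply, Complex.conj_I, Complex.mul_im, Complex.neg_re, Complex.neg_im,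
    Complex.I_re, Complex.I_im, Complex.mul_re, Complex.add_re] at h1 h2
  apply Complex.ext
  · simp only [Complex.conj_re]
    linarith
  · simp only [Complex.conj_im]
    linarith

section Space

variable {E : Type*} [AddCommGroup E] [Module ℂ E]

/-- The vector space `E` with the seminorm of the form `q`. -/
@[nolint unusedArguments]
def FormSpace (_ : PosForm E) : Type _ := E

variable (q : PosForm E)

instance : AddCommGroup (FormSpace q) := inferInstanceAs (AddCommGroup E)
instance : Module ℂ (FormSpace q) := inferInstanceAs (Module ℂ E)

/-- The identity as a map to `FormSpace q`. -/
def toForm : E ≃ₗ[ℂ] FormSpace q := LinearEquiv.refl ℂ _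

/-- The inner product core of a positive semidefinite form. -/
abbrev formCore : PreInnerProductSpace.Core ℂ (FormSpace q) where
  inner r s := q.form ((toForm q).symm r) ((toForm q).symm s)
  conj_inner_symm r s := q.conj_form _ _
  re_inner_nonneg r := (Complex.nonneg_iff.1 (q.nonneg ((toForm q).symm r))).1
  add_left r s t := by simp
  smul_left r s c := by simp

instance : SeminormedAddCommGroup (FormSpace q) :=
  InnerProductSpace.Core.toSeminormedAddCommGroup (c := formCore q)

instance : InnerProductSpace ℂ (FormSpace q) := InnerProductSpace.ofCore (formCore q)

theorem inner_toForm (r s : E) : ⟪toForm q r, toForm q s⟫_ℂ = q.form r s := rfl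

theorem norm_toForm_sq (r : E) : ((‖toForm q r‖ ^ 2 : ℝ) : ℂ) = q.form r r := by
  rw [← inner_toForm, inner_self_eq_norm_sq_to_K]
  simp

theorem PosForm.norm_form_le (r s : E) :
    ‖q.form r s‖ ^ 2 ≤ (q.form r r).re * (q.form s s).re := by
  rw [← norm_toForm_sq, ← norm_toForm_sq, Complex.ofReal_re, Complex.ofReal_re, ← mul_pow]
  exact pow_le_pow_left₀ (norm_nonneg _) (norm_inner_le_norm (toForm q r) (toForm q s)) 2

/-- The Hilbert space of a positive semidefinite form. -/
abbrev FormHilbert : Type _ := UniformSpace.Completion (FormSpace q)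

/-- The class of a vector in the Hilbert space of a form. -/
def cls (r : E) : FormHilbert q := ((toForm q r : FormSpace q) : FormHilbert q)

/-- The completion of a seminormed space is separated, so null vectors of the form disappear without
a separate quotient. -/
theorem inner_cls (r s : E) : ⟪cls q r, cls q s⟫_ℂ = q.form r s := by
  rw [cls, cls, UniformSpace.Completion.inner_coe, inner_toForm]

theorem ext_cls {F : Type*} [NormedAddCommGroup F] [InnerProductSpace ℂ F]
    {S S' : FormHilbert q →L[ℂ] F} (h : ∀ r, S (cls q r) = S' (cls q r)) : S = S' := by
  ext v
  induction v using UniformSpace.Completion.induction_on with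
  | hp => exact isClosed_eq S.continuous S'.continuous
  | ih a => exact h ((toForm q).symm a)

theorem ext_inner_cls {v v' : FormHilbert q} (h : ∀ r, ⟪cls q r, v⟫_ℂ = ⟪cls q r, v'⟫_ℂ) :
    v = v' := by
  refine ext_inner_left ℂ fun w => ?_
  induction w using UniformSpace.Completion.induction_on with
  | hp => exact isClosed_eq (by fun_prop) (by fun_prop)
  | ih a => exact h ((toForm q).symm a)

variable {q} {h : PosForm E} (hle : ∀ r, q.form r r ≤ h.form r r)

/-- The identity of `E` as a contraction between the Hilbert spaces of two forms `q ≤ h`. -/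
def formContraction : FormHilbert h →L[ℂ] FormHilbert q :=
  (((toForm q).toLinearMap ∘ₗ (toForm h).symm.toLinearMap).mkContinuous 1 fun r => by
    rw [one_mul, ← sq_le_sq₀ (norm_nonneg _) (norm_nonneg _)]
    have := hle ((toForm h).symm r)
    rw [← norm_toForm_sq, ← norm_toForm_sq, Complex.real_le_real] at this
    exact this).completion

theorem formContraction_cls (r : E) : formContraction hle (cls h r) = cls q r := by
  rw [formContraction, cls]
  exact ContinuousLinearMap.completion_apply_coe _ _

/-- The positive operator on the Hilbert space of `h` that represents a form `q ≤ h`. -/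
def formOp : FormHilbert h →L[ℂ] FormHilbert h :=
  (formContraction hle).adjoint ∘L formContraction hle

theorem formOp_isPositive : (formOp hle).IsPositive :=
  ContinuousLinearMap.isPositive_adjoint_comp_self _

/-- The Radon–Nikodym property: with the contraction `C` from the space of `h` to that of `q`, the
operator `C† C` moves the form `q` into the inner product of `h`. -/
theorem inner_formOp (r s : E) : ⟪cls h r, formOp hle (cls h s)⟫_ℂ = q.form r s := by
  rw [formOp, ContinuousLinearMap.comp_apply, ContinuousLinearMap.adjoint_inner_right,
    formContraction_cls, formContraction_cls, inner_cls]

end Space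

/-! ## Strategies from forms -/

theorem isDensityOperator_rankOne {H : Type} [NormedAddCommGroup H] [InnerProductSpace ℂ H]
    [CompleteSpace H] {ξ : H} (hξ : ⟪ξ, ξ⟫_ℂ = 1) :
    IsDensityOperator (InnerProductSpace.rankOne ℂ ξ ξ) := by
  refine ⟨InnerProductSpace.isPositive_rankOne_self ξ, fun ι e => ?_⟩
  have := e.hasSum_inner_mul_inner ξ ξ
  rw [hξ] at this
  simpa [inner_smul_right] using this

theorem hasTrace_mul_rankOne {H : Type} [NormedAddCommGroup H] [InnerProductSpace ℂ H]
    (S : H →L[ℂ] H) (ξ : H) :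
    HasTrace (S * InnerProductSpace.rankOne ℂ ξ ξ) ⟪ξ, S ξ⟫_ℂ := fun ι e => by
  simpa [inner_smul_right] using e.hasSum_inner_mul_inner ξ (S ξ)

/-- Alice's outcomes are forms `q x a` with sum `h`, Bob's outcomes are multipliers `m y b`. -/
theorem isCommutingOperator_of_forms {X Y A B : Type} [Fintype A] [Fintype B] [Nonempty X]
    {E : Type} [AddCommGroup E] [Module ℂ E] (q : X → A → PosForm E) (h : PosForm E)
    (hq : ∀ x r s, ∑ a, (q x a).form r s = h.form r s) (m : Y → B → E →ₗ[ℂ] E)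
    (hm : ∀ x a y b r s, (q x a).form r (m y b s) = (q x a).form (m y b r) s)
    (hm0 : ∀ y b r, 0 ≤ h.form r (m y b r))
    (hm1 : ∀ y r s, ∑ b, h.form r (m y b s) = h.form r s) (e : E)
    (he : h.form e e = 1) (p : Correlation X Y A B)
    (hp : ∀ a b x y, (p a b x y : ℂ) = (q x a).form e (m y b e)) : IsCommutingOperator p := by
  have hqle : ∀ x a r, (q x a).form r r ≤ h.form r r := fun x a r => by
    rw [← hq x]
    exact Finset.single_le_sum (f := fun a => (q x a).form r r)
      (fun a _ => (q x a).nonneg r) (Finset.mem_univ a)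
  -- Bob's multipliers need not be bounded a priori. Their forms lie below `h`, so they too are
  -- represented by bounded positive operators.
  let n : Y → B → PosForm E := fun y b =>
    { form := h.form.compl₂ (m y b)
      nonneg := fun r => hm0 y b r }
  have hn : ∀ y b r s, (n y b).form r s = h.form r (m y b s) := fun _ _ _ _ => rfl
  have hnsum : ∀ y r s, ∑ b, (n y b).form r s = h.form r s := fun y r s => by
    simp only [hn, hm1]
  have hnle : ∀ y b r, (n y b).form r r ≤ h.form r r := fun y b r => by
    rw [← hnsum y]
    exact Finset.single_le_sum (f := fun b => (n y b).form r r)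
      (fun b _ => (n y b).nonneg r) (Finset.mem_univ b)
  have hN : ∀ y b s, formOp (hnle y b) (cls h s) = cls h (m y b s) := fun y b s =>
    ext_inner_cls h fun r => by rw [inner_formOp, inner_cls, hn]
  refine ⟨FormHilbert h, inferInstance, inferInstance, inferInstance,
    InnerProductSpace.rankOne ℂ (cls h e) (cls h e), fun x a => formOp (hqle x a),
    fun y b => formOp (hnle y b), isDensityOperator_rankOne (by rw [inner_cls, he]),
    fun x a => formOp_isPositive _, fun x => ?_, fun y b => formOp_isPositive _, fun y => ?_,
    fun x a y b => ?_, fun a b x y => ?_⟩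
  · refine ext_cls h fun s => ext_inner_cls h fun r => ?_
    simp [inner_sum, inner_formOp, hq, inner_cls]
  · refine ext_cls h fun s => ext_inner_cls h fun r => ?_
    simp [inner_sum, inner_formOp, hnsum, inner_cls]
  -- Moving Bob's self-adjoint operator to the left argument turns the two orders of the product
  -- into `q(r, m s)` and `q(m r, s)`, which agree by `hm`.
  · refine ext_cls h fun s => ext_inner_cls h fun r => ?_
    rw [mul_apply_eq_comp, mul_apply_eq_comp, hN, inner_formOp,
      ← (formOp_isPositive (hnle y b)).isSelfAdjoint.isSymmetric.apply_clm, hN, inner_formOp, hm]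
  · rw [hp]
    have := hasTrace_mul_rankOne (formOp (hqle x a) * formOp (hnle y b)) (cls h e)
    rwa [mul_apply_eq_comp, hN, inner_formOp] at this

/-! ## From sequential to commuting operator strategies -/

theorem IsSequentialONS.isCommutingOperator {X Y A B : Type} [Fintype A] [Fintype B] [Nonempty X]
    {p : Correlation X Y A B} (hp : IsSequentialONS p) : IsCommutingOperator p := by
  obtain ⟨𝓐, _, _, _, 𝓑, _, _, _, σ, T, f, hσ, hT1, hT, hf0, hf1, hpT⟩ := hp
  have hstar : ∀ y b, star (f y b) = f y b := fun y b => (IsSelfAdjoint.of_nonneg (hf0 y b)).star_eq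
  let q : X → A → PosForm 𝓑 := fun x a =>
    { form := LinearMap.mk₂'ₛₗ (starRingEnd ℂ) (RingHom.id ℂ) (fun r s => σ (T x a (star r * s)))
        (fun r r' s => by simp [add_mul]) (fun c r s => by simp)
        (fun r s s' => by simp [mul_add]) (fun c r s => by simp)
      nonneg := fun r => map_nonneg σ (map_nonneg (T x a) (star_mul_self_nonneg r)) }
  have hq : ∀ x a r s, (q x a).form r s = σ (T x a (star r * s)) := fun _ _ _ _ => rfl
  let x₀ : X := Classical.arbitrary X
  let h : PosForm 𝓑 :=
    { form := ∑ a, (q x₀ a).form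
      nonneg := fun r => by
        simp only [LinearMap.sum_apply]
        exact Finset.sum_nonneg fun a _ => (q x₀ a).nonneg r }
  have hh : ∀ r s, h.form r s = ∑ a, (q x₀ a).form r s := fun r s => by
    simp only [h, LinearMap.sum_apply]
  refine isCommutingOperator_of_forms q h (fun x r s => ?_) (fun y b => LinearMap.mulLeft ℂ (f y b))
    (fun x a y b r s => ?_) (fun y b r => ?_) (fun y r s => ?_) 1 ?_ p (fun a b x y => ?_)
  · simp only [hh, hq]
    rw [← map_sum, ← map_sum, hT x x₀]
  · simp only [hq, LinearMap.mulLeft_apply, star_mul, hstar, mul_assoc]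
  · simp only [hh, hq, LinearMap.mulLeft_apply, ← mul_assoc]
    exact Finset.sum_nonneg fun a _ => map_nonneg σ (map_nonneg (T x₀ a)
      (star_left_conjugate_nonneg (hf0 y b) r))
  · simp only [LinearMap.mulLeft_apply]
    rw [← map_sum, ← Finset.sum_mul, hf1, one_mul]
  · simp only [hh, hq, star_one, one_mul]
    rw [← map_sum, hT1, hσ]
  · simp only [hpT, hq, LinearMap.mulLeft_apply, star_one, one_mul, mul_one]

/-! ## The functional of a density operator -/

section Density

variable {H : Type} [NormedAddCommGroup H] [InnerProductSpace ℂ H] {ι : Type}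

theorem hasSum_norm_inner_sq (e : HilbertBasis ι ℂ H) (v : H) :
    HasSum (fun i => ‖⟪e i, v⟫_ℂ‖ ^ 2) (‖v‖ ^ 2) := by
  have h := e.hasSum_inner_mul_inner v v
  rw [← Complex.hasSum_ofReal]
  convert! h using 1
  · ext i
    rw [← inner_conj_symm v (e i), mul_comm, Complex.mul_conj, Complex.normSq_eq_norm_sq]
  · rw [inner_self_eq_norm_sq_to_K]
    simp

/-- Cyclicity of the trace for two Hilbert–Schmidt operators. -/
theorem hasSum_inner_of_hasTrace [CompleteSpace H] (e : HilbertBasis ι ℂ H) {R : H →L[ℂ] H}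
    (hR : IsSelfAdjoint R) (hs : Summable fun i => ‖R (e i)‖ ^ 2) (S : H →L[ℂ] H) {t : ℂ}
    (ht : HasSum (fun i => ⟪e i, S (R (R (e i)))⟫_ℂ) t) :
    HasSum (fun i => ⟪R (e i), S (R (e i))⟫_ℂ) t := by
  -- The terms of a double series that is absolutely summable by Parseval and `2 |u v| ≤ |u|² +
  -- |v|²`. The two orders of summation give the two traces.
  let g : ι × ι → ℂ := fun k => ⟪R (e k.1), e k.2⟫_ℂ * ⟪e k.2, S (R (e k.1))⟫_ℂ
  have hsq : ∀ v : ι → H, Summable (fun j => ‖v j‖ ^ 2) →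
      Summable fun k : ι × ι => ‖⟪e k.2, v k.1⟫_ℂ‖ ^ 2 := fun v hv => by
    rw [summable_prod_of_nonneg fun k => by positivity]
    refine ⟨fun j => (hasSum_norm_inner_sq e (v j)).summable, ?_⟩
    simpa only [(hasSum_norm_inner_sq e _).tsum_eq] using hv
  have hSR : Summable fun j => ‖S (R (e j))‖ ^ 2 := by
    refine Summable.of_nonneg_of_le (fun j => by positivity) (fun j => ?_) (hs.mul_left (‖S‖ ^ 2))
    rw [← mul_pow]
    exact pow_le_pow_left₀ (norm_nonneg _) (S.le_opNorm _) 2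
  have hg : Summable g := by
    refine Summable.of_norm_bounded ((hsq _ hs).add (hsq _ hSR)) fun k => ?_
    simp only [g, norm_mul]
    rw [← inner_conj_symm, RCLike.norm_conj]
    nlinarith [sq_nonneg (‖⟪e k.2, R (e k.1)⟫_ℂ‖ - ‖⟪e k.2, S (R (e k.1))⟫_ℂ‖),
      sq_nonneg (‖⟪e k.2, R (e k.1)⟫_ℂ‖), sq_nonneg (‖⟪e k.2, S (R (e k.1))⟫_ℂ‖)]
  have h1 := hg.hasSum.prod_fiberwise fun j => e.hasSum_inner_mul_inner (R (e j)) (S (R (e j)))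
  -- Summing over the argument of `R` first is Parseval for the vectors `(S R)† e_i` and `R e_i`.
  have h2 := ((Equiv.prodComm ι ι).hasSum_iff.2 hg.hasSum).prod_fiberwise
    (g := fun i => ⟪e i, S (R (R (e i)))⟫_ℂ) fun i => by
      have := e.hasSum_inner_mul_inner ((S ∘L R).adjoint (e i)) (R (e i))
      simp only [ContinuousLinearMap.adjoint_inner_left, ContinuousLinearMap.comp_apply] at this
      convert! this using 1
      funext j
      change ⟪R (e j), e i⟫_ℂ * ⟪e i, S (R (e j))⟫_ℂ = _
      rw [mul_comm]
      exact congrArg _ (hR.isSymmetric (e j) (e i))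
  rwa [ht.unique h2]

/-- The functional `S ↦ Tr (S ρ)` of a density operator `ρ`. -/
theorem IsDensityOperator.exists_functional [CompleteSpace H] {ρ : H →L[ℂ] H}
    (hρ : IsDensityOperator ρ) : ∃ φ : (H →L[ℂ] H) →ₗ[ℂ] ℂ, φ 1 = 1 ∧
      (∀ S, 0 ≤ φ (star S * S)) ∧ ∀ S t, HasTrace (S * ρ) t → φ S = t := by
  obtain ⟨w, e, -⟩ := exists_hilbertBasis ℂ H
  have hρ0 : 0 ≤ ρ := (ContinuousLinearMap.nonneg_iff_isPositive ρ).2 hρ.1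
  -- With `ρ = R²` the functional is defined as `∑ ⟨R e_i, S R e_i⟩`: this converges absolutely for
  -- every bounded `S` and is visibly positive on `S⋆ S`.
  let R := CFC.sqrt ρ
  have hR : IsSelfAdjoint R := IsSelfAdjoint.of_nonneg (CFC.sqrt_nonneg ρ)
  have hRR : R * R = ρ := CFC.sqrt_mul_sqrt_self ρ
  have hsum : HasSum (fun i => ‖R (e i)‖ ^ 2) 1 := by
    rw [← Complex.hasSum_ofReal]
    convert! hρ.2 w e using 1
    ext i
    rw [← hRR, mul_apply_eq_comp]
    have := hR.isSymmetric (e i) (R (e i))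
    simp only [ContinuousLinearMap.coe_coe] at this
    rw [← this, inner_self_eq_norm_sq_to_K]
    simp
  have hle : ∀ (S : H →L[ℂ] H) i, ‖⟪R (e i), S (R (e i))⟫_ℂ‖ ≤ ‖S‖ * ‖R (e i)‖ ^ 2 := fun S i => by
    refine (norm_inner_le_norm _ _).trans ?_
    nlinarith [S.le_opNorm (R (e i)), norm_nonneg (R (e i))]
  have hS : ∀ S : H →L[ℂ] H, Summable fun i => ⟪R (e i), S (R (e i))⟫_ℂ := fun S =>
    Summable.of_norm_bounded (hsum.summable.mul_left ‖S‖) (hle S)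
  let φ : (H →L[ℂ] H) →ₗ[ℂ] ℂ :=
    { toFun := fun S => ∑' i, ⟪R (e i), S (R (e i))⟫_ℂ
      map_add' := fun S S' => by
        simp only [add_apply, inner_add_right]
        exact (hS S).tsum_add (hS S')
      map_smul' := fun c S => by
        simp only [smul_apply, inner_smul_right, RingHom.id_apply, smul_eq_mul]
        exact tsum_mul_left }
  have hφ : ∀ S t, HasTrace (S * ρ) t → φ S = t := fun S t ht => by
    have := ht w e
    rw [← hRR] at this
    exact (hasSum_inner_of_hasTrace e hR hsum.summable S this).tsum_eq
  refine ⟨φ, hφ 1 1 (by rw [one_mul]; exact hρ.2), fun S => ?_, hφ⟩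
  refine tsum_nonneg fun i => ?_
  rw [mul_apply_eq_comp, ContinuousLinearMap.star_eq_adjoint,
    ContinuousLinearMap.adjoint_inner_right]
  rw [inner_self_eq_norm_sq_to_K]
  rw [← RCLike.ofReal_pow]
  exact Complex.zero_le_real.2 (sq_nonneg _)

end Density

/-! ## Strategies in C⋆-algebras -/

/-- A commuting operator strategy in a C⋆-algebra `D` with a state `φ`. The POVMs are given by
square roots `S x a`, `R y b` of their elements. -/
structure RootStrategy {X Y A B : Type} [Fintype A] [Fintype B] (p : Correlation X Y A B)
    (D : Type) [CStarAlgebra D] (φ : D →ₗ[ℂ] ℂ) (S : X → A → D) (R : Y → B → D) : Prop where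
  map_one : φ 1 = 1
  map_nonneg : ∀ s, 0 ≤ φ (star s * s)
  isSelfAdjoint_left : ∀ x a, IsSelfAdjoint (S x a)
  sum_left : ∀ x, ∑ a, S x a * S x a = 1
  isSelfAdjoint_right : ∀ y b, IsSelfAdjoint (R y b)
  sum_right : ∀ y, ∑ b, R y b * R y b = 1
  commute : ∀ x a y b, Commute (S x a) (R y b)
  apply_eq : ∀ a b x y, (p a b x y : ℂ) = φ (S x a * S x a * (R y b * R y b))

theorem IsCommutingOperator.exists_rootStrategy {X Y A B : Type} [Fintype A] [Fintype B]
    {p : Correlation X Y A B} (hp : IsCommutingOperator p) :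
    ∃ (D : Type) (_ : CStarAlgebra D) (φ : D →ₗ[ℂ] ℂ) (S : X → A → D) (R : Y → B → D),
      RootStrategy p D φ S R := by
  obtain ⟨H, _, _, _, ρ, M, N, hρ, hM, hM1, hN, hN1, hc, hpt⟩ := hp
  obtain ⟨φ, h1, hpos, hφ⟩ := hρ.exists_functional
  have hM0 : ∀ x a, 0 ≤ M x a := fun x a =>
    (ContinuousLinearMap.nonneg_iff_isPositive _).2 (hM x a)
  have hN0 : ∀ y b, 0 ≤ N y b := fun y b =>
    (ContinuousLinearMap.nonneg_iff_isPositive _).2 (hN y b)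
  have hMs : ∀ x a, CFC.sqrt (M x a) * CFC.sqrt (M x a) = M x a := fun x a =>
    CFC.sqrt_mul_sqrt_self _ (hM0 x a)
  have hNs : ∀ y b, CFC.sqrt (N y b) * CFC.sqrt (N y b) = N y b := fun y b =>
    CFC.sqrt_mul_sqrt_self _ (hN0 y b)
  refine ⟨H →L[ℂ] H, inferInstance, φ, fun x a => CFC.sqrt (M x a), fun y b => CFC.sqrt (N y b),
    h1, hpos, fun x a => IsSelfAdjoint.of_nonneg (CFC.sqrt_nonneg _), fun x => ?_,
    fun y b => IsSelfAdjoint.of_nonneg (CFC.sqrt_nonneg _), fun y => ?_, fun x a y b => ?_,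
    fun a b x y => ?_⟩
  · simp only [hMs, hM1]
  · simp only [hNs, hN1]
  · have h1 : Commute (CFC.sqrt (M x a)) (N y b) :=
      -- Functional calculus preserves commutation, so the two roots are introduced one after the
      -- other.
      Commute.cfcₙ_nnreal (show Commute (M x a) (N y b) from hc x a y b) _
    exact (Commute.cfcₙ_nnreal h1.symm _).symm
  · rw [hMs, hNs, hφ _ _ (hpt a b x y)]

/-- The completely positive map `s ↦ c⋆ j(s) c`. -/
def conjCP {𝓐 𝓑 : Type*} [CStarAlgebra 𝓐] [PartialOrder 𝓐] [StarOrderedRing 𝓐] [CStarAlgebra 𝓑]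
    [PartialOrder 𝓑] [StarOrderedRing 𝓑] (j : 𝓑 →⋆ₐ[ℂ] 𝓐) (c : 𝓐) : 𝓑 →CP 𝓐 where
  toFun s := star c * j s * c
  map_add' s t := by simp [mul_add, add_mul]
  map_smul' z s := by simp
  map_cstarMatrix_nonneg' k M hM := by
    change 0 ≤ M.map (fun s => star c * j s * c)
    rw [StarOrderedRing.nonneg_iff] at hM
    induction hM using AddSubmonoid.closure_induction with
    -- A square `Z⋆ Z` is sent to the square `W⋆ W` with entries `W = j(Z) c`; positive matrices are
    -- generated by squares.
    | mem M hM =>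
      obtain ⟨Z, rfl⟩ := hM
      have : (star Z * Z).map (fun s => star c * j s * c) =
          star (Z.map fun s => j s * c) * Z.map fun s => j s * c := by
        ext i l
        simp [CStarMatrix.mul_apply, CStarMatrix.star_apply, Finset.mul_sum, Finset.sum_mul,
          mul_assoc, map_star]
      rw [this]
      exact star_mul_self_nonneg _
    | zero =>
      refine le_of_eq (CStarMatrix.ext fun i l => ?_)
      simp
    | add M N _ _ hM hN =>
      refine (add_nonneg hM hN).trans_eq (CStarMatrix.ext fun i l => ?_)
      simp [mul_add, add_mul]

theorem conjCP_apply {𝓐 𝓑 : Type*} [CStarAlgebra 𝓐] [PartialOrder 𝓐] [StarOrderedRing 𝓐]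
    [CStarAlgebra 𝓑] [PartialOrder 𝓑] [StarOrderedRing 𝓑] (j : 𝓑 →⋆ₐ[ℂ] 𝓐) (c : 𝓐) (s : 𝓑) :
    conjCP j c s = star c * j s * c := rfl

/-- Bob's algebra is the commutant `K` of Alice's roots. On `K` the map `s ↦ S s S` equals
multiplication by `S²`, so summing over outcomes gives the inclusion of `K`, whatever the question.
-/
theorem RootStrategy.isSequentialONS {X Y A B : Type} [Fintype A] [Fintype B]
    {p : Correlation X Y A B} {D : Type} [CStarAlgebra D] {φ : D →ₗ[ℂ] ℂ} {S : X → A → D}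
    {R : Y → B → D} (h : RootStrategy p D φ S R) : IsSequentialONS p := by
  let : PartialOrder D := CStarAlgebra.spectralOrder D
  have : StarOrderedRing D := CStarAlgebra.spectralOrderedRing D
  let K : StarSubalgebra ℂ D := StarSubalgebra.centralizer ℂ (Set.range fun i : X × A => S i.1 i.2)
  have : IsClosed (K : Set D) := Set.isClosed_centralizer _
  let : CStarAlgebra K := StarSubalgebra.cstarAlgebra K
  let : PartialOrder K := CStarAlgebra.spectralOrder K
  have : StarOrderedRing K := CStarAlgebra.spectralOrderedRing K
  have hK : ∀ (s : K) x a, S x a * (s : D) = s * S x a := fun s x a =>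
    ((StarSubalgebra.mem_centralizer_iff ℂ).1 s.2 _ ⟨(x, a), rfl⟩).1
  have hR : ∀ y b, R y b ∈ K := fun y b => by
    refine (StarSubalgebra.mem_centralizer_iff ℂ).2 ?_
    rintro _ ⟨⟨x, a⟩, rfl⟩
    rw [(h.isSelfAdjoint_left x a).star_eq]
    exact ⟨h.commute x a y b, h.commute x a y b⟩
  let r : Y → B → K := fun y b => ⟨R y b, hR y b⟩
  have hr : ∀ y b, star (r y b) = r y b := fun y b => Subtype.ext (h.isSelfAdjoint_right y b).star_eq
  let T : X → A → K →CP D := fun x a => conjCP K.subtype (S x a)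
  have hT : ∀ x a (s : K), T x a s = S x a * S x a * s := fun x a s => by
    rw [conjCP_apply, StarSubalgebra.subtype_apply, (h.isSelfAdjoint_left x a).star_eq, mul_assoc, ← hK, mul_assoc]
  have hTs : ∀ x s, ∑ a, T x a s = s := fun x s => by
    simp only [hT]
    rw [← Finset.sum_mul, h.sum_left, one_mul]
  refine ⟨D, inferInstance, inferInstance, inferInstance, K, inferInstance, inferInstance,
    inferInstance, PositiveLinearMap.mk₀ φ fun s hs => ?_, T, fun y b => r y b * r y b, h.map_one,
    fun x => hTs x 1, fun x x' s => by rw [hTs, hTs], fun y b => ?_, fun y => ?_, fun a b x y => ?_⟩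
  · obtain ⟨t, rfl⟩ := CStarAlgebra.nonneg_iff_eq_star_mul_self.1 hs
    exact h.map_nonneg t
  · have := star_mul_self_nonneg (r y b)
    rwa [hr] at this
  · refine Subtype.ext ?_
    have := h.sum_right y
    simpa [r] using this
  · rw [h.apply_eq, hT]
    rfl

/-! ## Projective dilations -/

section Dilation

open Matrix

variable {A D : Type*} [DecidableEq A] [Ring D]

/-- The involution of `D ⊕ D^A` that maps the first summand to `D^A` by the column `v`. -/
def columnReflection (v : A → D) : Matrix (Unit ⊕ A) (Unit ⊕ A) D :=
  fromBlocks 0 (of fun _ a => v a) (of fun a _ => v a)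
    (1 - (of fun a (_ : Unit) => v a) * of fun (_ : Unit) a => v a)

/-- The hypothesis says that the column `v` is an isometry `D → D^A`; the lower right block `1 - v
v⋆` completes it to an involution. -/
theorem columnReflection_mul_self [Fintype A] {v : A → D} (hv : ∑ a, v a * v a = 1) :
    columnReflection v * columnReflection v = 1 := by
  have h : (of fun (_ : Unit) a => v a) * (of fun a (_ : Unit) => v a) = 1 := by
    ext i j
    simp [Matrix.mul_apply, hv]
  have h' : ∀ W : Matrix Unit A D,
      (of fun (_ : Unit) a => v a) * ((of fun a (_ : Unit) => v a) * W) = W := fun W => by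
    rw [← Matrix.mul_assoc, h, Matrix.one_mul]
  rw [columnReflection, fromBlocks_multiply, ← fromBlocks_one]
  congr 1
  · simp [h]
  · simp [Matrix.mul_sub, h']
  · simp [Matrix.sub_mul, Matrix.mul_assoc, h]
  · simp [Matrix.mul_sub, Matrix.sub_mul, Matrix.mul_assoc, h']

theorem conjTranspose_columnReflection [StarRing D] {v : A → D}
    (hv : ∀ a, IsSelfAdjoint (v a)) : (columnReflection v)ᴴ = columnReflection v := by
  have h1 : (of fun (_ : Unit) a => v a)ᴴ = of fun a (_ : Unit) => v a := by
    ext i j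
    simp [(hv _).star_eq]
  have h2 : (of fun a (_ : Unit) => v a)ᴴ = of fun (_ : Unit) a => v a := by
    ext i j
    simp [(hv _).star_eq]
  rw [columnReflection, fromBlocks_conjTranspose, h1, h2]
  simp [h1, h2]

theorem columnReflection_commute [Fintype A] {v : A → D} {u : D} (hu : ∀ a, Commute (v a) u) :
    Commute (columnReflection v) (diagonal fun _ => u) := by
  ext i j
  rw [mul_diagonal, diagonal_mul]
  rcases i with i | a <;> rcases j with j | b
  · simp [columnReflection]
  · simpa [columnReflection] using (hu b).eq
  · simpa [columnReflection] using (hu a).eq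
  · have : v a * v b * u = u * (v a * v b) := ((hu a).mul_left (hu b)).eq
    by_cases hab : a = b
    · subst hab
      simpa [columnReflection, Matrix.mul_apply, sub_mul, mul_sub] using this
    · simpa [columnReflection, Matrix.mul_apply, hab] using this

/-- The coordinate projections of `D ⊕ D^A`; the first summand is added to the one of `a₀`. -/
def coordProj (D : Type*) [Ring D] (a₀ a : A) : Matrix (Unit ⊕ A) (Unit ⊕ A) D :=
  diagonal fun i => if Sum.elim (fun _ => a₀) id i = a then 1 else 0

theorem coordProj_mul [Fintype A] (a₀ a a' : A) :
    coordProj D a₀ a * coordProj D a₀ a' = if a = a' then coordProj D a₀ a else 0 := by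
  rw [coordProj, coordProj, diagonal_mul_diagonal]
  split_ifs with h
  · subst h
    congr 1
    funext i
    by_cases h1 : Sum.elim (fun _ => a₀) id i = a <;> simp [h1]
  · rw [← diagonal_zero]
    congr 1
    funext i
    by_cases h1 : Sum.elim (fun _ => a₀) id i = a
    · simp [h1, h]
    · simp [h1]

theorem sum_coordProj [Fintype A] (a₀ : A) : ∑ a, coordProj D a₀ a = 1 := by
  ext i j
  rw [Matrix.sum_apply]
  by_cases hij : i = j
  · subst hij
    simp [coordProj]
  · simp [coordProj, hij]

theorem conjTranspose_coordProj [StarRing D] (a₀ a : A) :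
    (coordProj D a₀ a)ᴴ = coordProj D a₀ a := by
  rw [coordProj, diagonal_conjTranspose]
  congr 1
  funext i
  by_cases h : Sum.elim (fun _ => a₀) id i = a <;> simp [h]

theorem coordProj_commute [Fintype A] (a₀ a : A) (u : D) :
    Commute (coordProj D a₀ a) (diagonal fun _ => u) := by
  rw [Commute, SemiconjBy, coordProj, diagonal_mul_diagonal, diagonal_mul_diagonal]
  simp

/-- The upper left entry of the reflection is `0`, so the summand attached to `a₀` to make the
projections sum to `1` does not affect the corner. -/
theorem columnReflection_coordProj_apply [Fintype A] (v : A → D) (a₀ a : A) (u : D) :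
    (columnReflection v * coordProj D a₀ a * columnReflection v * diagonal (fun _ => u) :
      Matrix _ _ D) (Sum.inl ()) (Sum.inl ()) = v a * v a * u := by
  rw [mul_diagonal, Matrix.mul_apply]
  simp only [columnReflection, coordProj, mul_diagonal, Fintype.sum_sum_type, fromBlocks_apply₁₁,
    fromBlocks_apply₁₂, fromBlocks_apply₂₁, of_apply, Sum.elim_inr, id]
  rw [Finset.sum_eq_single a (fun b _ hb => by simp [hb]) (by simp)]
  simp

end Dilation

/-- The embedding of a C⋆-algebra as the scalar matrices. -/
def scalarHom (n D : Type) [Fintype n] [DecidableEq n] [CStarAlgebra D] [PartialOrder D]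
    [StarOrderedRing D] : D →⋆ₐ[ℂ] CStarMatrix n n D where
  toFun u := CStarMatrix.ofMatrixStarAlgEquiv (Matrix.diagonal fun _ => u)
  map_one' := by rw [Matrix.diagonal_one, map_one]
  map_mul' u v := by rw [← map_mul, Matrix.diagonal_mul_diagonal]
  map_zero' := (congrArg _ (Matrix.diagonal_zero (n := n) (α := D))).trans (map_zero _)
  map_add' u v := by rw [← map_add, Matrix.diagonal_add]
  commutes' c := rfl
  map_star' u := by
    rw [← map_star, Matrix.star_eq_conjTranspose, Matrix.diagonal_conjTranspose]
    rfl

-- Naimark dilation. Conjugating the coordinate projections by the self-adjoint unitary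
-- `columnReflection (S x)` gives a PVM whose corner is `S²`. Bob's operators become scalar
-- matrices, which commute with the reflection because its entries are built from the `S x a`. Bob's
-- side changes only by a ⋆-homomorphism, so projectivity already achieved there survives.
open Classical in
theorem RootStrategy.dilate {X Y A B : Type} [Fintype A] [Fintype B] [Nonempty A]
    {p : Correlation X Y A B} {D : Type} [CStarAlgebra D] {φ : D →ₗ[ℂ] ℂ} {S : X → A → D}
    {R : Y → B → D} (h : RootStrategy p D φ S R) :
    ∃ (D' : Type) (_ : CStarAlgebra D') (φ' : D' →ₗ[ℂ] ℂ) (S' : X → A → D') (j : D →⋆ₐ[ℂ] D'),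
      RootStrategy p D' φ' S' (fun y b => j (R y b)) ∧
      ∀ x a a', S' x a * S' x a' = if a = a' then S' x a else 0 := by
  let _ : PartialOrder D := CStarAlgebra.spectralOrder D
  have _ : StarOrderedRing D := CStarAlgebra.spectralOrderedRing D
  let θ : Matrix (Unit ⊕ A) (Unit ⊕ A) D ≃⋆ₐ[ℂ] CStarMatrix (Unit ⊕ A) (Unit ⊕ A) D :=
    CStarMatrix.ofMatrixStarAlgEquiv
  let a₀ : A := Classical.arbitrary A
  let P : X → A → CStarMatrix (Unit ⊕ A) (Unit ⊕ A) D := fun x a =>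
    θ (columnReflection (S x) * coordProj D a₀ a * columnReflection (S x))
  have hU : ∀ x, columnReflection (S x) * columnReflection (S x) = 1 := fun x =>
    columnReflection_mul_self (h.sum_left x)
  have hP : ∀ x a a', P x a * P x a' = if a = a' then P x a else 0 := fun x a a' => by
    have : columnReflection (S x) * coordProj D a₀ a * columnReflection (S x) *
        (columnReflection (S x) * coordProj D a₀ a' * columnReflection (S x)) =
        columnReflection (S x) * (coordProj D a₀ a * coordProj D a₀ a') * columnReflection (S x) := by
      simp only [mul_assoc]
      rw [← mul_assoc (columnReflection (S x)) (columnReflection (S x)), hU, one_mul]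
    simp only [P]
    rw [← map_mul, this, coordProj_mul]
    split_ifs <;> simp
  have hP1 : ∀ x, ∑ a, P x a = 1 := fun x => by
    simp only [P]
    rw [← map_sum, ← Finset.sum_mul, ← Finset.mul_sum, sum_coordProj, mul_one, hU]
    rfl
  let φ' : CStarMatrix (Unit ⊕ A) (Unit ⊕ A) D →ₗ[ℂ] ℂ :=
    { toFun := fun M => φ (M (Sum.inl ()) (Sum.inl ()))
      map_add' := fun M N => by rw [CStarMatrix.add_apply, map_add]
      map_smul' := fun c M => by rw [CStarMatrix.smul_apply, map_smul, RingHom.id_apply] }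
  refine ⟨CStarMatrix (Unit ⊕ A) (Unit ⊕ A) D, inferInstance, φ', P, scalarHom _ D,
    ⟨?_, fun M => ?_, fun x a => ?_, fun x => ?_, fun y b => ?_, fun y => ?_, fun x a y b => ?_,
      fun a b x y => ?_⟩, hP⟩
  · exact h.map_one
  · change 0 ≤ φ ((star M * M) _ _)
    rw [CStarMatrix.mul_apply, map_sum]
    exact Finset.sum_nonneg fun k _ => h.map_nonneg _
  · rw [IsSelfAdjoint, ← map_star, Matrix.star_eq_conjTranspose, Matrix.conjTranspose_mul,
      Matrix.conjTranspose_mul, conjTranspose_columnReflection (h.isSelfAdjoint_left x),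
      conjTranspose_coordProj, ← mul_assoc]
  · simp [hP, hP1]
  · exact (h.isSelfAdjoint_right y b).map _
  · simp only [← map_mul, ← map_sum, h.sum_right]
    exact _root_.map_one (scalarHom (Unit ⊕ A) D)
  · have hc : Commute (columnReflection (S x)) (Matrix.diagonal fun _ => R y b) :=
      columnReflection_commute fun a => h.commute x a y b
    have hc' := coordProj_commute a₀ a (R y b)
    exact ((hc.mul_left hc').mul_left hc).map θ
  · rw [hP, if_pos rfl, ← map_mul, h.apply_eq]
    exact congrArg φ (columnReflection_coordProj_apply (S x) a₀ a _).symm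

theorem RootStrategy.swap {X Y A B : Type} [Fintype A] [Fintype B] {p : Correlation X Y A B}
    {D : Type} [CStarAlgebra D] {φ : D →ₗ[ℂ] ℂ} {S : X → A → D} {R : Y → B → D}
    (h : RootStrategy p D φ S R) : RootStrategy (fun b a y x => p a b x y) D φ R S where
  map_one := h.map_one
  map_nonneg := h.map_nonneg
  isSelfAdjoint_left := h.isSelfAdjoint_right
  sum_left := h.sum_right
  isSelfAdjoint_right := h.isSelfAdjoint_left
  sum_right := h.sum_left
  commute y b x a := (h.commute x a y b).symm
  apply_eq b a y x := by
    have := h.commute x a y b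
    rw [h.apply_eq, ((this.mul_left this).mul_right (this.mul_left this)).eq]

open Classical in
/-- Commuting operator strategies can be chosen projective. -/
theorem IsCommutingOperator.exists_projective {X Y A B : Type} [Fintype A] [Fintype B]
    [Nonempty A] [Nonempty B] {p : Correlation X Y A B} (hp : IsCommutingOperator p) :
    ∃ (D : Type) (_ : CStarAlgebra D) (φ : D →ₗ[ℂ] ℂ) (S : X → A → D) (R : Y → B → D),
      RootStrategy p D φ S R ∧ (∀ x a a', S x a * S x a' = if a = a' then S x a else 0) ∧
      ∀ y b b', R y b * R y b' = if b = b' then R y b else 0 := by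
  obtain ⟨D, _, φ, S, R, h⟩ := hp.exists_rootStrategy
  -- First Alice is dilated, then Bob after exchanging the roles; the embedding `j₂` keeps Alice's
  -- operators projections.
  obtain ⟨D₁, _, φ₁, S₁, j₁, h₁, hS₁⟩ := h.dilate
  obtain ⟨D₂, _, φ₂, R₂, j₂, h₂, hR₂⟩ := h₁.swap.dilate
  refine ⟨D₂, _, φ₂, fun x a => j₂ (S₁ x a), R₂, h₂.swap, fun x a a' => ?_, hR₂⟩
  rw [← map_mul, hS₁]
  split_ifs <;> simp

/-! ## Words -/

section Words

variable {I : Type} (ℛ : Relations I)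

theorem isStarProjection_gen (i : I) : IsStarProjection (gen ℛ i) where
  isIdempotentElem := univ_ext fun m => (ℛ.isStarProjection m.D m.gen m.holds i).isIdempotentElem
  isSelfAdjoint := univ_ext fun m => (ℛ.isStarProjection m.D m.gen m.holds i).isSelfAdjoint

/-- The product of the generators in a list. -/
def word (l : List I) : Univ ℛ := (l.map (gen ℛ)).prod

@[simp]
theorem word_nil : word ℛ [] = 1 := rfl

@[simp]
theorem word_cons (i : I) (l : List I) : word ℛ (i :: l) = gen ℛ i * word ℛ l := by
  simp [word]

theorem word_append (l l' : List I) : word ℛ (l ++ l') = word ℛ l * word ℛ l' := by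
  simp [word]

theorem star_word (l : List I) : star (word ℛ l) = word ℛ l.reverse := by
  induction l with
  | nil => simp
  | cons i l ih =>
    rw [word_cons, star_mul, ih, List.reverse_cons, word_append, word_cons, word_nil, mul_one,
      (isStarProjection_gen ℛ i).isSelfAdjoint.star_eq]

variable {ℛ}

theorem mem_words {n : ℕ} {w : Univ ℛ} : w ∈ words ℛ n ↔ ∃ l : List I, l.length ≤ n ∧ word ℛ l = w :=
  Iff.rfl

theorem word_mem_words {l : List I} {n : ℕ} (h : l.length ≤ n) : word ℛ l ∈ words ℛ n := ⟨l, h, rfl⟩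

theorem words_mono {m n : ℕ} (h : m ≤ n) : words ℛ m ⊆ words ℛ n := fun _ ⟨l, hl, hw⟩ =>
  ⟨l, hl.trans h, hw⟩

theorem star_mem_words {n : ℕ} {w : Univ ℛ} (h : w ∈ words ℛ n) : star w ∈ words ℛ n := by
  obtain ⟨l, hl, rfl⟩ := mem_words.1 h
  rw [star_word]
  exact word_mem_words (by simpa using hl)

theorem deg_le {n : ℕ} {w : Univ ℛ} (h : w ∈ words ℛ n) : deg w ≤ n := Nat.sInf_le h

variable (ℛ) in
/-- The span of the words of length at most `n`. -/
abbrev wordSpan (n : ℕ) : Submodule ℂ (Univ ℛ) := Submodule.span ℂ (words ℛ n)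

theorem word_mem_wordSpan {l : List I} {n : ℕ} (h : l.length ≤ n) : word ℛ l ∈ wordSpan ℛ n :=
  Submodule.subset_span (word_mem_words h)

theorem one_mem_wordSpan (n : ℕ) : 1 ∈ wordSpan ℛ n := Submodule.subset_span (one_mem_words ℛ n)

theorem gen_mem_wordSpan (i : I) : gen ℛ i ∈ wordSpan ℛ 1 :=
  Submodule.subset_span (gen_mem_words ℛ le_rfl i)

theorem wordSpan_mono {m n : ℕ} (h : m ≤ n) : wordSpan ℛ m ≤ wordSpan ℛ n :=
  Submodule.span_mono (words_mono h)

theorem mul_mem_wordSpan {m n : ℕ} {s t : Univ ℛ} (hs : s ∈ wordSpan ℛ m)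
    (ht : t ∈ wordSpan ℛ n) : s * t ∈ wordSpan ℛ (m + n) := by
  have := Submodule.mul_mem_mul hs ht
  rw [Submodule.span_mul_span] at this
  refine Submodule.span_mono ?_ this
  rintro _ ⟨_, ⟨l, hl, rfl⟩, _, ⟨l', hl', rfl⟩, rfl⟩
  exact ⟨l ++ l', by simpa using add_le_add hl hl', by simp⟩

theorem star_mem_wordSpan {n : ℕ} {s : Univ ℛ} (hs : s ∈ wordSpan ℛ n) :
    star s ∈ wordSpan ℛ n := by
  induction hs using Submodule.span_induction with
  | mem w hw => exact Submodule.subset_span (star_mem_words hw)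
  | zero => simp
  | add s t _ _ hs ht => simpa using add_mem hs ht
  | smul c s _ hs => simpa using Submodule.smul_mem _ (star c) hs

theorem star_mul_mem_wordSpan {n : ℕ} {s t : Univ ℛ} (hs : s ∈ wordSpan ℛ n)
    (ht : t ∈ wordSpan ℛ n) : star s * t ∈ wordSpan ℛ (2 * n) := by
  rw [two_mul]
  exact mul_mem_wordSpan (star_mem_wordSpan hs) ht

/-- The evaluation of noncommutative polynomials at the generators. -/
theorem lift_gen_mem_wordSpan (r : FreeAlgebra ℂ I) :
    ∃ n, FreeAlgebra.lift ℂ (gen ℛ) r ∈ wordSpan ℛ n := by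
  induction r using FreeAlgebra.induction with
  | grade0 c =>
    refine ⟨0, ?_⟩
    rw [AlgHom.commutes, Algebra.algebraMap_eq_smul_one]
    exact Submodule.smul_mem _ _ (one_mem_wordSpan 0)
  | grade1 i => exact ⟨1, by simpa using gen_mem_wordSpan i⟩
  | mul r s hr hs =>
    obtain ⟨m, hm⟩ := hr
    obtain ⟨n, hn⟩ := hs
    exact ⟨m + n, by simpa using mul_mem_wordSpan hm hn⟩
  | add r s hr hs =>
    obtain ⟨m, hm⟩ := hr
    obtain ⟨n, hn⟩ := hs
    refine ⟨max m n, ?_⟩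
    rw [map_add]
    exact add_mem (wordSpan_mono (le_max_left m n) hm) (wordSpan_mono (le_max_right m n) hn)

/-- The form `L (s⋆ t)` of a functional. -/
def functionalForm (L : Univ ℛ →ₗ[ℂ] ℂ) (W : Submodule ℂ (Univ ℛ))
    (h : ∀ t ∈ W, 0 ≤ L (star t * t)) : PosForm W where
  form := LinearMap.mk₂'ₛₗ (starRingEnd ℂ) (RingHom.id ℂ)
    (fun s t => L (star (s : Univ ℛ) * t)) (fun r r' s => by simp [add_mul])
    (fun c r s => by simp) (fun r s s' => by simp [mul_add]) (fun c r s => by simp)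
  nonneg t := h t t.2

/-- This matches the quadratic form of a moment matrix with `L (t⋆ t)`, so that `Γ ⪰ 0` becomes
positivity of `L` on the span of the words. -/
theorem sum_star_mul_apply (L : Univ ℛ →ₗ[ℂ] ℂ) {ι : Type*} (f : ι → Univ ℛ)
    (c : ι →₀ ℂ) : L (star (Finsupp.linearCombination ℂ f c) * Finsupp.linearCombination ℂ f c) =
      c.sum fun i ci => c.sum fun j cj => star ci * L (star (f i) * f j) * cj := by
  simp only [Finsupp.linearCombination_apply, Finsupp.sum, star_sum, Finset.sum_mul,
    Finset.mul_sum, map_sum, star_smul, smul_mul_assoc, mul_smul_comm, map_smul, smul_eq_mul]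
  rw [Finset.sum_comm]
  refine Finset.sum_congr rfl fun i _ => Finset.sum_congr rfl fun j _ => ?_
  ring

end Words

/-! ## Functionals of level `n` -/

section Level

variable {X Y A B : Type} [Fintype A] [Fintype B] [Nonempty B] [Nonempty Y]

/-- The functionals whose moment matrices are feasible at level `n`. -/
structure IsLevel (n : ℕ) (L : AlgAB X Y A B →ₗ[ℂ] ℂ) : Prop where
  map_one : L 1 = 1
  nonneg : ∀ t ∈ wordSpan (relAB X Y A B) n, 0 ≤ L (star t * t)
  nonsignaling : ∀ (x x' : X) (w v : words (relAB X Y A B) n) (r s : words (relB Y B) n),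
    deg (w : AlgAB X Y A B) + deg (v : AlgAB X Y A B) + deg (r : AlgB Y B) + deg (s : AlgB Y B)
      ≤ 2 * n →
    L (star (w : AlgAB X Y A B) * (∑ a, (T a x (star (r : AlgB Y B) * (s : AlgB Y B)) -
      T a x' (star (r : AlgB Y B) * (s : AlgB Y B)))) * v) = 0

variable {n : ℕ} {L : AlgAB X Y A B →ₗ[ℂ] ℂ}

theorem IsLevel.mono {m : ℕ} (h : IsLevel n L) (hmn : m ≤ n) : IsLevel m L where
  map_one := h.map_one
  nonneg t ht := h.nonneg t (wordSpan_mono hmn ht)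
  nonsignaling x x' w v r s hd := h.nonsignaling x x' ⟨w, words_mono hmn w.2⟩
    ⟨v, words_mono hmn v.2⟩ ⟨r, words_mono hmn r.2⟩ ⟨s, words_mono hmn s.2⟩
    (hd.trans (by lia))

/-- The positive semidefinite form of a functional of level `n`. -/
def IsLevel.form (h : IsLevel n L) : PosForm (wordSpan (relAB X Y A B) n) :=
  functionalForm L _ h.nonneg

theorem IsLevel.form_apply (h : IsLevel n L) (s t : wordSpan (relAB X Y A B) n) :
    h.form.form s t = L (star (s : AlgAB X Y A B) * t) := rfl

theorem isFeasible_iff {Γ : MomentMatrix X Y A B n} : IsFeasible n Γ ↔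
    ∃ L : AlgAB X Y A B →ₗ[ℂ] ℂ, IsLevel n L ∧
      ∀ w v : words (relAB X Y A B) n, Γ w v = L (star (w : AlgAB X Y A B) * v) := by
  constructor
  · intro h
    obtain ⟨L, hL, hns⟩ := h.nonsignaling
    refine ⟨L, ⟨?_, fun t ht => ?_, hns⟩, fun w v => (hL w v).symm⟩
    · have := hL ⟨1, one_mem_words _ n⟩ ⟨1, one_mem_words _ n⟩
      rwa [h.normalized, star_one, one_mul] at this
    · obtain ⟨c, rfl⟩ := (Finsupp.mem_span_iff_linearCombination ℂ _ _).1 ht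
      rw [sum_star_mul_apply]
      simp only [hL]
      exact h.posSemidef.2 c
  · rintro ⟨L, h, hΓ⟩
    refine ⟨⟨?_, fun c => ?_⟩, ?_, fun w v w' v' hwv => ?_, L, fun w v => (hΓ w v).symm,
      h.nonsignaling⟩
    · ext w v
      rw [Matrix.conjTranspose_apply, hΓ, hΓ]
      exact h.form.conj_form ⟨w, Submodule.subset_span w.2⟩ ⟨v, Submodule.subset_span v.2⟩
    · simp only [hΓ]
      rw [← sum_star_mul_apply]
      exact h.nonneg _ ((Finsupp.mem_span_iff_linearCombination ℂ _ _).2 ⟨c, rfl⟩)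
    · rw [hΓ, star_one, one_mul, h.map_one]
    · rw [hΓ, hΓ, hwv]

/-- Multiplying from the left by a projection `g` can only decrease `L (w⋆ w)`: the difference is `L
(t⋆ t)` with `t = (1 - g) w`, still in the span of words of length at most `n`. -/
theorem IsLevel.apply_word_le (h : IsLevel n L) {l : List (A × B × X × Y)} (hl : l.length ≤ n) :
    L (star (word _ l) * word _ l) ≤ 1 := by
  induction l with
  | nil => simp [h.map_one]
  | cons i l ih =>
    have hl' : l.length ≤ n := (Nat.le_succ _).trans hl
    refine le_trans ?_ (ih hl')
    have hp := isStarProjection_gen (relAB X Y A B) i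
    have h1 := h.nonneg _ (sub_mem (word_mem_wordSpan (ℛ := relAB X Y A B) hl')
      (word_mem_wordSpan (ℛ := relAB X Y A B) hl))
    have h2 : star (word (relAB X Y A B) l - word _ (i :: l)) * (word _ l - word _ (i :: l)) =
        star (word _ l) * word _ l - star (word _ (i :: l)) * word _ (i :: l) := by
      simp only [word_cons, star_sub, star_mul, hp.isSelfAdjoint.star_eq, sub_mul, mul_sub,
        mul_assoc]
      simp only [← mul_assoc (gen _ i) (gen _ i), hp.isIdempotentElem.eq]
      abel
    rw [h2, map_sub] at h1
    exact sub_nonneg.1 h1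

theorem IsLevel.norm_apply_le (h : IsLevel n L) {w : AlgAB X Y A B}
    (hw : w ∈ words (relAB X Y A B) (2 * n)) : ‖L w‖ ≤ 1 := by
  obtain ⟨l, hl, rfl⟩ := mem_words.1 hw
  -- The word is cut into halves of length at most `n`. The first half is reversed because
  -- Cauchy–Schwarz puts a star on it.
  have h1 : (l.take n).reverse.length ≤ n := by simp
  have h2 : (l.drop n).length ≤ n := by
    rw [List.length_drop]
    lia
  have h3 := h.form.norm_form_le ⟨_, word_mem_wordSpan h1⟩ ⟨_, word_mem_wordSpan h2⟩
  simp only [h.form_apply] at h3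
  have h4 := (Complex.le_def.1 (h.apply_word_le h1)).1
  have h5 := (Complex.le_def.1 (h.apply_word_le h2)).1
  have h6 := (Complex.nonneg_iff.1 (h.nonneg _ (word_mem_wordSpan h1))).1
  have h7 := (Complex.nonneg_iff.1 (h.nonneg _ (word_mem_wordSpan h2))).1
  rw [Complex.one_re] at h4 h5
  have h8 : star (word (relAB X Y A B) (l.take n).reverse) * word _ (l.drop n) = word _ l := by
    rw [star_word, List.reverse_reverse, ← word_append, List.take_append_drop]
  rw [h8] at h3
  rw [← sq_le_one_iff₀ (norm_nonneg _)]
  exact h3.trans (mul_le_one₀ h4 h7 h5)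

theorem IsLevel.apply_gen_nonneg (h : IsLevel n L) (hn : 1 ≤ n) (i : A × B × X × Y) :
    0 ≤ L (gen _ i) := by
  have := h.nonneg _ (wordSpan_mono hn (gen_mem_wordSpan i))
  have hp := isStarProjection_gen (relAB X Y A B) i
  rwa [hp.isSelfAdjoint.star_eq, hp.isIdempotentElem.eq] at this

/-! ## Limits of functionals -/

open Filter Topology

/-- The vectors on which a family of functionals is eventually bounded. -/
def eventuallyBounded {κ V : Type*} [AddCommGroup V] [Module ℂ V] (l : Filter κ)
    (L : κ → V →ₗ[ℂ] ℂ) : Submodule ℂ V where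
  carrier := {t | ∃ C, ∀ᶠ k in l, ‖L k t‖ ≤ C}
  zero_mem' := ⟨0, by simp⟩
  add_mem' := by
    rintro s t ⟨C, hC⟩ ⟨C', hC'⟩
    refine ⟨C + C', ?_⟩
    filter_upwards [hC, hC'] with k h h'
    rw [map_add]
    exact (norm_add_le _ _).trans (add_le_add h h')
  smul_mem' := by
    rintro c t ⟨C, hC⟩
    refine ⟨‖c‖ * C, ?_⟩
    filter_upwards [hC] with k h
    rw [map_smul, norm_smul]
    gcongr

/-- Bounded families in `ℂ` converge along an ultrafilter. This defines the limit on the subspace of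
eventually bounded vectors; outside it the linear extension is arbitrary. -/
theorem exists_tendsto_linearMap {κ V : Type*} [AddCommGroup V] [Module ℂ V] (U : Ultrafilter κ)
    (L : κ → V →ₗ[ℂ] ℂ) : ∃ Λ : V →ₗ[ℂ] ℂ, ∀ t ∈ eventuallyBounded U L,
      Tendsto (fun k => L k t) U (𝓝 (Λ t)) := by
  have hex : ∀ t : eventuallyBounded U L, ∃ z : ℂ, Tendsto (fun k => L k t) U (𝓝 z) := fun t => by
    obtain ⟨C, hC⟩ := t.2
    obtain ⟨z, -, hz⟩ := (isCompact_closedBall (0 : ℂ) C).ultrafilter_le_nhds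
      (U.map fun k => L k t) (by
        rw [Ultrafilter.coe_map, le_principal_iff, mem_map]
        filter_upwards [hC] with k h
        simpa using h)
    exact ⟨z, hz⟩
  choose f hf using hex
  obtain ⟨Λ, hΛ⟩ := LinearMap.exists_extend
    (linearMapOfTendsto f (fun k => (L k).domRestrict (eventuallyBounded U L)) (l := (U : Filter κ))
      (tendsto_pi_nhds.2 hf))
  refine ⟨Λ, fun t ht => ?_⟩
  have : Λ t = f ⟨t, ht⟩ := LinearMap.congr_fun hΛ ⟨t, ht⟩
  rw [this]
  exact hf ⟨t, ht⟩

/-- Each condition of level `N` is closed under pointwise limits on the vectors it involves. The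
functional `Λ` is chosen before `N`, so if the levels tend to infinity the same `Λ` has all levels.
-/
theorem exists_isLevel_limit {κ : Type*} (U : Ultrafilter κ) (n : κ → ℕ)
    {L : κ → AlgAB X Y A B →ₗ[ℂ] ℂ} (hL : ∀ᶠ k in U, IsLevel (n k) (L k)) :
    ∃ Λ : AlgAB X Y A B →ₗ[ℂ] ℂ, ∀ N, (∀ᶠ k in U, N ≤ n k) → IsLevel N Λ ∧
      ∀ t ∈ wordSpan (relAB X Y A B) (2 * N), Tendsto (fun k => L k t) U (𝓝 (Λ t)) := by
  obtain ⟨Λ, hΛ⟩ := exists_tendsto_linearMap U L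
  refine ⟨Λ, fun N hN => ?_⟩
  have hLN : ∀ᶠ k in U, IsLevel N (L k) := by
    filter_upwards [hL, hN] with k h h' using h.mono h'
  have ht : ∀ t ∈ wordSpan (relAB X Y A B) (2 * N), Tendsto (fun k => L k t) U (𝓝 (Λ t)) := by
    refine fun t ht => hΛ t (Submodule.span_le.2 (fun w hw => ?_) ht)
    exact ⟨1, by filter_upwards [hLN] with k h using h.norm_apply_le hw⟩
  refine ⟨⟨?_, fun t h => ?_, fun x x' w v r s hd => ?_⟩, ht⟩
  · refine tendsto_nhds_unique (ht 1 (one_mem_wordSpan _)) (tendsto_const_nhds.congr' ?_)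
    filter_upwards [hLN] with k h using h.map_one.symm
  · refine ge_of_tendsto (ht _ (star_mul_mem_wordSpan h h)) ?_
    filter_upwards [hLN] with k hk using hk.nonneg t h
  · have h0 : ∀ᶠ k in U, L k (star (w : AlgAB X Y A B) *
        (∑ a, (T a x (star (r : AlgB Y B) * (s : AlgB Y B)) -
          T a x' (star (r : AlgB Y B) * (s : AlgB Y B)))) * v) = 0 := by
      filter_upwards [hLN] with k h using h.nonsignaling x x' w v r s hd
    -- The bound `0` suffices for convergence here, so no word length of the vector has to be
    -- estimated.
    refine tendsto_nhds_unique (hΛ _ ⟨0, ?_⟩) (tendsto_const_nhds.congr' ?_)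
    · filter_upwards [h0] with k hk
      rw [hk, norm_zero]
    · filter_upwards [h0] with k hk using hk.symm

end Level

/-! ## Strategies from functionals -/

/-- Bob's projections `g` are elements of a ⋆-algebra, Alice's outcomes are functionals `ψ x a` that
are positive on noncommutative polynomials in `g`. -/
theorem isCommutingOperator_of_functionals {X Y A B : Type} [Fintype A] [Fintype B] [Nonempty X]
    {C : Type*} [Ring C] [StarRing C] [Algebra ℂ C] [StarModule ℂ C] {g : B × Y → C}
    (hg : ∀ i, IsStarProjection (g i)) (hg1 : ∀ y, ∑ b, g (b, y) = 1) (ψ : X → A → C →ₗ[ℂ] ℂ)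
    (hψ : ∀ x a (r : FreeAlgebra ℂ (B × Y)),
      0 ≤ ψ x a (star (FreeAlgebra.lift ℂ g r) * FreeAlgebra.lift ℂ g r))
    (hsum : ∀ x x' (r s : FreeAlgebra ℂ (B × Y)),
      ∑ a, ψ x a (star (FreeAlgebra.lift ℂ g r) * FreeAlgebra.lift ℂ g s) =
        ∑ a, ψ x' a (star (FreeAlgebra.lift ℂ g r) * FreeAlgebra.lift ℂ g s))
    (hone : ∀ x, ∑ a, ψ x a 1 = 1) {p : Correlation X Y A B}
    (hp : ∀ a b x y, (p a b x y : ℂ) = ψ x a (g (b, y))) : IsCommutingOperator p := by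
  -- The forms are pulled back to the free algebra: positivity is known only for polynomials in `g`,
  -- and the Hilbert space must live in `Type` while `C` may be in a larger universe.
  let ev : FreeAlgebra ℂ (B × Y) →ₐ[ℂ] C := FreeAlgebra.lift ℂ g
  let q : X → A → PosForm (FreeAlgebra ℂ (B × Y)) := fun x a =>
    { form := LinearMap.mk₂'ₛₗ (starRingEnd ℂ) (RingHom.id ℂ)
        (fun r s => ψ x a (star (ev r) * ev s))
        (fun r r' s => by simp [add_mul]) (fun c r s => by simp)
        (fun r s s' => by simp [mul_add]) (fun c r s => by simp)
      nonneg := hψ x a }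
  have hq : ∀ x a r s, (q x a).form r s = ψ x a (star (ev r) * ev s) := fun _ _ _ _ => rfl
  let x₀ : X := Classical.arbitrary X
  let h : PosForm (FreeAlgebra ℂ (B × Y)) :=
    { form := ∑ a, (q x₀ a).form
      nonneg := fun r => by
        simp only [LinearMap.sum_apply]
        exact Finset.sum_nonneg fun a _ => (q x₀ a).nonneg r }
  have hh : ∀ r s, h.form r s = ∑ a, (q x₀ a).form r s := fun r s => by
    simp only [h, LinearMap.sum_apply]
  let m : Y → B → FreeAlgebra ℂ (B × Y) →ₗ[ℂ] FreeAlgebra ℂ (B × Y) := fun y b =>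
    LinearMap.mulLeft ℂ (FreeAlgebra.ι ℂ (b, y))
  have hm : ∀ y b r, ev (m y b r) = g (b, y) * ev r := fun y b r => by
    simp [m, ev]
  have hsymm : ∀ x a y b r s, (q x a).form r (m y b s) = (q x a).form (m y b r) s := by
    intro x a y b r s
    rw [hq, hq, hm, hm, star_mul, (hg _).isSelfAdjoint.star_eq, mul_assoc]
  refine isCommutingOperator_of_forms q h (fun x r s => ?_) m hsymm (fun y b r => ?_)
    (fun y r s => ?_) 1 ?_ p (fun a b x y => ?_)
  · simp only [hh, hq]
    exact hsum x x₀ r s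
  · rw [hh]
    refine Finset.sum_nonneg fun a _ => ?_
    -- For a projection `g` one has `r⋆ g r = (g r)⋆ (g r)`.
    have : (q x₀ a).form r (m y b r) = (q x₀ a).form (m y b r) (m y b r) := by
      rw [← hsymm, hq, hq, hm, hm, hm, ← mul_assoc (g _), (hg _).isIdempotentElem.eq]
    rw [this]
    exact (q x₀ a).nonneg _
  · simp only [hh, hq, hm]
    rw [Finset.sum_comm]
    refine Finset.sum_congr rfl fun a _ => ?_
    rw [← map_sum, ← Finset.mul_sum, ← Finset.sum_mul, hg1, one_mul]
  · simp only [hh, hq, map_one, star_one, one_mul, hone]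
  · rw [hp, hq, hm, map_one, star_one, one_mul, mul_one]

/-! ### Scores of functionals -/

section Scores

open Filter Topology

variable {X Y A B : Type} [Fintype A] [Fintype B]

-- A deterministic strategy in `ℂ`; it ensures that the suprema are taken over nonempty sets.
variable (X Y A B) in
theorem exists_isCommutingOperator [Nonempty X] [Nonempty A] [Nonempty B] :
    ∃ p : Correlation X Y A B, IsCommutingOperator p := by
  classical
  let a₀ : A := Classical.arbitrary A
  let b₀ : B := Classical.arbitrary B
  have h : RootStrategy (fun a b _ _ => if a = a₀ then if b = b₀ then 1 else 0 else 0) ℂ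
      LinearMap.id (fun (_ : X) a => if a = a₀ then 1 else 0)
      (fun (_ : Y) b => if b = b₀ then 1 else 0) :=
    { map_one := rfl
      map_nonneg := fun s => star_mul_self_nonneg s
      isSelfAdjoint_left := fun x a => by split_ifs <;> simp
      sum_left := fun x => by simp
      isSelfAdjoint_right := fun y b => by split_ifs <;> simp
      sum_right := fun y => by simp
      commute := fun x a y b => Commute.all _ _
      apply_eq := fun a b x y => by split_ifs <;> simp }
  exact ⟨_, h.isSequentialONS.isCommutingOperator⟩

theorem entry_eq {n : ℕ} (hn : 1 ≤ n) {Γ : MomentMatrix X Y A B n} {L : AlgAB X Y A B →ₗ[ℂ] ℂ}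
    (hΓ : ∀ w v : words (relAB X Y A B) n, Γ w v = L (star (w : AlgAB X Y A B) * v))
    (a : A) (b : B) (x : X) (y : Y) : entry hn Γ a b x y = L (gen _ (a, b, x, y)) := by
  rw [entry, hΓ, star_one, one_mul]

theorem gen_mem_wordSpan_two_mul {n : ℕ} (hn : 1 ≤ n) (i : A × B × X × Y) :
    gen _ i ∈ wordSpan (relAB X Y A B) (2 * n) :=
  wordSpan_mono (by lia) (gen_mem_wordSpan i)

variable [Fintype X] [Fintype Y] (G : NonlocalGame X Y A B)

/-- The score of a functional. -/
def functionalScore (L : AlgAB X Y A B →ₗ[ℂ] ℂ) : ℂ :=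
  ∑ a, ∑ b, ∑ x, ∑ y, (G.payoff a b x y : ℂ) * L (gen _ (a, b, x, y))

theorem functionalScore_eq {L : AlgAB X Y A B →ₗ[ℂ] ℂ} {p : Correlation X Y A B}
    (hp : ∀ a b x y, (p a b x y : ℂ) = L (gen _ (a, b, x, y))) :
    functionalScore G L = (G.score p : ℂ) := by
  simp only [functionalScore, NonlocalGame.score, Complex.ofReal_sum, Complex.ofReal_mul, hp]

theorem tendsto_functionalScore {κ : Type*} {l : Filter κ} {L : κ → AlgAB X Y A B →ₗ[ℂ] ℂ}
    {Λ : AlgAB X Y A B →ₗ[ℂ] ℂ} (h : ∀ i, Tendsto (fun k => L k (gen _ i)) l (𝓝 (Λ (gen _ i)))) :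
    Tendsto (fun k => functionalScore G (L k)) l (𝓝 (functionalScore G Λ)) :=
  tendsto_finsetSum _ fun a _ => tendsto_finsetSum _ fun b _ => tendsto_finsetSum _ fun x _ =>
    tendsto_finsetSum _ fun y _ => (h (a, b, x, y)).const_mul _

end Scores

section Equivalence

variable {X Y A B : Type} [Fintype A] [Fintype B] [Nonempty B] [Nonempty Y]

/-! ## From functionals of all levels to commuting operator strategies -/

theorem T_lift_mem_wordSpan (a : A) (x : X) (r : FreeAlgebra ℂ (B × Y)) :
    ∃ n, T a x (FreeAlgebra.lift ℂ (gen (relB Y B)) r) ∈ wordSpan (relAB X Y A B) n := by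
  induction r using FreeAlgebra.induction with
  | grade0 c =>
    -- Since `T a x` is not unital, constants go to multiples of `∑_b f_{ab|xy}`, which needs words
    -- of length one.
    refine ⟨1, ?_⟩
    rw [AlgHom.commutes, Algebra.algebraMap_eq_smul_one, map_smul,
      T_one a x (Classical.arbitrary Y)]
    exact Submodule.smul_mem _ _ (sum_mem fun b _ => gen_mem_wordSpan _)
  | grade1 i =>
    refine ⟨1, ?_⟩
    rw [FreeAlgebra.lift_ι_apply, T_gen]
    exact gen_mem_wordSpan _
  | mul r s hr hs =>
    obtain ⟨m, hm⟩ := hr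
    obtain ⟨n, hn⟩ := hs
    refine ⟨m + n, ?_⟩
    rw [map_mul, map_mul]
    exact mul_mem_wordSpan hm hn
  | add r s hr hs =>
    obtain ⟨m, hm⟩ := hr
    obtain ⟨n, hn⟩ := hs
    refine ⟨max m n, ?_⟩
    rw [map_add, map_add]
    exact add_mem (wordSpan_mono (le_max_left m n) hm) (wordSpan_mono (le_max_right m n) hn)

theorem sum_T_one (x : X) : ∑ a : A, T a x (1 : AlgB Y B) = 1 := by
  simp only [T_one _ x (Classical.arbitrary Y)]
  exact gen_holds.sum_eq x _

theorem IsLevel.apply_sum_T {n : ℕ} {L : AlgAB X Y A B →ₗ[ℂ] ℂ} (h : IsLevel n L) (x x' : X)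
    {u : AlgB Y B} (hu : u ∈ wordSpan (relB Y B) n) :
    ∑ a, L (T a x u) = ∑ a, L (T a x' u) := by
  induction hu using Submodule.span_induction with
  | mem s hs =>
    have h1 := deg_le (one_mem_words (relAB X Y A B) 0)
    have h2 := deg_le (one_mem_words (relB Y B) 0)
    -- Only the last factor is a nontrivial word: the three units have degree `0`, so the degree
    -- bound holds.
    have := h.nonsignaling x x' ⟨1, one_mem_words _ n⟩ ⟨1, one_mem_words _ n⟩
      ⟨1, one_mem_words _ n⟩ ⟨s, hs⟩ (by
        have := deg_le hs
        simp only
        lia)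
    simpa only [star_one, one_mul, mul_one, map_sum, map_sub, Finset.sum_sub_distrib,
      sub_eq_zero] using this
  | zero => simp
  | add s t _ _ hs ht => simp only [map_add, Finset.sum_add_distrib, hs, ht]
  | smul c s _ hs => simp only [map_smul, ← Finset.smul_sum, hs]

/-- Alice's outcomes are the functionals `L ∘ T_{a|x}` on Bob's algebra. They are positive on
polynomials because `T_{a|x}` is a ⋆-homomorphism. The level required grows with the degree of the
polynomial, so all levels are used. -/
theorem isCommutingOperator_of_isLevel [Nonempty X] {L : AlgAB X Y A B →ₗ[ℂ] ℂ}
    (hL : ∀ n, IsLevel n L) {p : Correlation X Y A B}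
    (hp : ∀ a b x y, (p a b x y : ℂ) = L (gen _ (a, b, x, y))) : IsCommutingOperator p := by
  let ψ : X → A → AlgB Y B →ₗ[ℂ] ℂ := fun x a =>
    { toFun := fun u => L (T a x u)
      map_add' := fun u v => by rw [map_add, map_add]
      map_smul' := fun c u => by rw [map_smul, map_smul, RingHom.id_apply] }
  have hψ : ∀ x a u, ψ x a u = L (T a x u) := fun _ _ _ => rfl
  refine isCommutingOperator_of_functionals (isStarProjection_gen (relB Y B))
    (fun y => univ_ext fun m => ?_) ψ (fun x a r => ?_) (fun x x' r s => ?_) (fun x => ?_)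
    (fun a b x y => ?_)
  · simpa only [map_sum, eval_gen, map_one] using m.holds.sum_eq y
  · obtain ⟨n, hn⟩ := T_lift_mem_wordSpan a x r
    rw [hψ, map_mul, map_star]
    exact (hL n).nonneg _ hn
  · obtain ⟨k, hk⟩ := lift_gen_mem_wordSpan (ℛ := relB Y B) r
    obtain ⟨l, hl⟩ := lift_gen_mem_wordSpan (ℛ := relB Y B) s
    exact (hL (k + l)).apply_sum_T x x' (mul_mem_wordSpan (star_mem_wordSpan hk) hl)
  · simp only [hψ]
    rw [← map_sum, sum_T_one, (hL 0).map_one]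
  · rw [hp, hψ, T_gen]

/-! ## From commuting operator strategies to functionals of all levels -/

/-- In a model where `f_{ab|xy}` is a product of commuting projections `P_{a|x}` and `Q_{b|y}`, the
⋆-homomorphism `T_{a|x}` is the evaluation of Bob's algebra times `P_{a|x}`. -/
theorem eval_T_word {m : Model (relAB X Y A B)} {m' : Model (relB Y B)} (θ : m'.D →+* m.D)
    (P : X → A → m.D) (hP : ∀ x a, P x a * P x a = P x a)
    (hc : ∀ x a i, Commute (P x a) (θ (m'.gen i)))
    (hg : ∀ a b x y, m.gen (a, b, x, y) = P x a * θ (m'.gen (b, y))) (a : A) (x : X)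
    (l : List (B × Y)) :
    eval m (T a x (word _ l)) = P x a * θ (eval m' (word _ l)) := by
  induction l with
  | nil =>
    have := m'.holds.sum_eq (Classical.arbitrary Y)
    rw [word_nil, T_one a x (Classical.arbitrary Y), map_sum, map_one, map_one, mul_one]
    simp only [eval_gen, hg]
    rw [← Finset.mul_sum, ← map_sum, this, map_one, mul_one]
  | cons i l ih =>
    rw [word_cons, map_mul, map_mul, T_gen, eval_gen, ih, hg, map_mul, map_mul, eval_gen,
      mul_assoc, ← mul_assoc (θ (m'.gen (i.1, i.2))), ← (hc x a i).eq, mul_assoc, ← mul_assoc, hP]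

theorem IsCommutingOperator.exists_isLevel [Nonempty A] {p : Correlation X Y A B}
    (hp : IsCommutingOperator p) : ∃ L : AlgAB X Y A B →ₗ[ℂ] ℂ, (∀ n, IsLevel n L) ∧
      ∀ a b x y, (p a b x y : ℂ) = L (gen _ (a, b, x, y)) := by
  obtain ⟨D, _, φ, P, Q, h, hP, hQ⟩ := hp.exists_projective
  have hPP : ∀ x a, P x a * P x a = P x a := fun x a => by rw [hP, if_pos rfl]
  have hQQ : ∀ y b, Q y b * Q y b = Q y b := fun y b => by rw [hQ, if_pos rfl]
  have hP1 : ∀ x, ∑ a, P x a = 1 := fun x => by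
    simpa only [hPP] using h.sum_left x
  have hQ1 : ∀ y, ∑ b, Q y b = 1 := fun y => by
    simpa only [hQQ] using h.sum_right y
  -- Models are nonzero algebras by definition; here this follows from `φ 1 = 1`.
  have _ : Nontrivial D := by
    refine ⟨⟨0, 1, fun h01 => ?_⟩⟩
    have := h.map_one
    rw [← h01, map_zero] at this
    exact zero_ne_one this
  have hmul : ∀ x a y b a' b', P x a * Q y b * (P x a' * Q y b') =
      P x a * P x a' * (Q y b * Q y b') := fun x a y b a' b' => by
    rw [mul_assoc, ← mul_assoc (Q y b), ← (h.commute x a' y b).eq, mul_assoc, mul_assoc]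
  let m : Model (relAB X Y A B) :=
    { D := D
      gen := fun i => P i.2.2.1 i.1 * Q i.2.2.2 i.2.1
      holds :=
        { star_eq := fun a b x y => by
            rw [star_mul, (h.isSelfAdjoint_left x a).star_eq, (h.isSelfAdjoint_right y b).star_eq,
              (h.commute x a y b).eq]
          mul_self := fun a b x y => by rw [hmul, hPP, hQQ]
          mul_of_ne := fun a b a' b' x y hne => by
            rw [hmul, hP, hQ]
            by_cases ha : a = a'
            · rw [if_neg fun hb : b = b' => hne (by rw [ha, hb]), mul_zero]
            · rw [if_neg ha, zero_mul]
          sum_eq_sum := fun a x y y' => by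
            simp only [← Finset.mul_sum, hQ1]
          sum_eq := fun x y => by
            simp only [← Finset.mul_sum, hQ1, mul_one, hP1] } }
  let m' : Model (relB Y B) :=
    { D := D
      gen := fun i => Q i.2 i.1
      holds :=
        { star_eq := fun b y => (h.isSelfAdjoint_right y b).star_eq
          mul_self := fun b y => hQQ y b
          mul_of_ne := fun b b' y hne => by rw [hQ, if_neg hne]
          sum_eq := hQ1 } }
  let L : AlgAB X Y A B →ₗ[ℂ] ℂ := φ ∘ₗ (eval m).toAlgHom.toLinearMap
  have hL : ∀ u, L u = φ (eval m u) := fun _ => rfl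
  refine ⟨L, fun n => ⟨?_, fun t _ => ?_, fun x x' w v r s _ => ?_⟩, fun a b x y => ?_⟩
  · rw [hL, map_one, h.map_one]
  · rw [hL, map_mul, map_star]
    exact h.map_nonneg _
  · obtain ⟨l, -, hl⟩ := mem_words.1 r.2
    obtain ⟨k, -, hk⟩ := mem_words.1 s.2
    -- In this model the sum of the `T_{a|x}` is Bob's word times `∑_a P_{a|x} = 1`, so
    -- non-signaling holds in the algebra itself, without any restriction on degrees.
    have hT : ∀ x, ∑ a, eval m (T a x (word _ (l.reverse ++ k))) =
        eval m' (word _ (l.reverse ++ k)) := fun x => by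
      have := fun a => eval_T_word (m := m) (m' := m') (RingHom.id D) P hPP
        (fun x a i => h.commute x a i.2 i.1) (fun _ _ _ _ => rfl) a x (l.reverse ++ k)
      simp only [this]
      rw [← Finset.sum_mul]
      exact (congrArg (· * _) (hP1 x)).trans (one_mul _)
    rw [hL, ← hl, ← hk, star_word, ← word_append, map_mul (eval m), map_mul (eval m),
      map_sum (eval m)]
    simp only [map_sub]
    rw [Finset.sum_sub_distrib, hT, hT, sub_self, mul_zero, zero_mul, map_zero]
  · rw [hL, eval_gen, h.apply_eq, hPP, hQQ]

theorem isCommutingOperator_iff_exists_isLevel [Nonempty X] [Nonempty A]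
    {p : Correlation X Y A B} : IsCommutingOperator p ↔
      ∃ L : AlgAB X Y A B →ₗ[ℂ] ℂ, (∀ n, IsLevel n L) ∧
        ∀ a b x y, (p a b x y : ℂ) = L (gen _ (a, b, x, y)) :=
  ⟨fun h => h.exists_isLevel, fun ⟨_, hL, hp⟩ => isCommutingOperator_of_isLevel hL hp⟩

/-! ## The limit of the hierarchy -/

open Filter Topology

theorem isRealizedAtAllLevels_iff [Nonempty X] [Nonempty A] {p : Correlation X Y A B} :
    IsRealizedAtAllLevels p ↔ IsCommutingOperator p := by
  rw [isCommutingOperator_iff_exists_isLevel]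
  constructor
  · rintro ⟨Γ, hΓ⟩
    have hex : ∀ n, ∃ L : AlgAB X Y A B →ₗ[ℂ] ℂ, 1 ≤ n → IsLevel n L ∧
        ∀ a b x y, (p a b x y : ℂ) = L (gen _ (a, b, x, y)) := fun n => by
      by_cases hn : 1 ≤ n
      · obtain ⟨L, hL, hLΓ⟩ := isFeasible_iff.1 (hΓ n hn).1
        refine ⟨L, fun _ => ⟨hL, fun a b x y => ?_⟩⟩
        rw [(hΓ n hn).2, entry_eq hn hLΓ]
      · exact ⟨0, fun h => absurd h hn⟩
    choose L hL using hex
    have h1 : ∀ N, ∀ᶠ k in (hyperfilter ℕ : Filter ℕ), N ≤ k := fun N =>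
      Nat.hyperfilter_le_atTop (eventually_ge_atTop N)
    -- Solutions of different levels need not be compatible; the limit replaces them by one
    -- functional with the same entries.
    obtain ⟨Λ, hΛ⟩ := exists_isLevel_limit (hyperfilter ℕ) id
      ((h1 1).mono fun k hk => (hL k hk).1)
    refine ⟨Λ, fun n => (hΛ n (h1 n)).1, fun a b x y => ?_⟩
    refine tendsto_nhds_unique (tendsto_const_nhds.congr' ?_)
      ((hΛ 1 (h1 1)).2 _ (gen_mem_wordSpan_two_mul le_rfl (a, b, x, y)))
    filter_upwards [h1 1] with k hk using (hL k hk).2 a b x y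
  · rintro ⟨L, hL, hp⟩
    refine ⟨fun n w v => L (star (w : AlgAB X Y A B) * v), fun n hn =>
      ⟨isFeasible_iff.2 ⟨L, hL n, fun _ _ => rfl⟩, fun a b x y => ?_⟩⟩
    rw [hp, entry_eq hn fun _ _ => rfl]

variable [Fintype X] [Fintype Y] {G : NonlocalGame X Y A B}

theorem mem_feasibleScores {n : ℕ} {v : ℝ} : v ∈ feasibleScores G n ↔
    1 ≤ n ∧ ∃ L : AlgAB X Y A B →ₗ[ℂ] ℂ, IsLevel n L ∧ (v : ℂ) = functionalScore G L := by
  constructor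
  · rintro ⟨hn, Γ, hΓ, hv⟩
    obtain ⟨L, hL, hLΓ⟩ := isFeasible_iff.1 hΓ
    refine ⟨hn, L, hL, hv.trans ?_⟩
    simp only [functionalScore, entry_eq hn hLΓ]
  · rintro ⟨hn, L, hL, hv⟩
    refine ⟨hn, fun w v => L (star (w : AlgAB X Y A B) * v),
      isFeasible_iff.2 ⟨L, hL, fun _ _ => rfl⟩, hv.trans ?_⟩
    simp only [functionalScore, entry_eq hn fun _ _ => rfl]

theorem IsCommutingOperator.score_mem [Nonempty A] {p : Correlation X Y A B}
    (hp : IsCommutingOperator p) {n : ℕ} (hn : 1 ≤ n) : G.score p ∈ feasibleScores G n := by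
  obtain ⟨L, hL, hpL⟩ := hp.exists_isLevel
  exact mem_feasibleScores.2 ⟨hn, L, hL n, (functionalScore_eq G hpL).symm⟩

theorem feasibleScores_nonempty [Nonempty X] [Nonempty A] {n : ℕ} (hn : 1 ≤ n) :
    (feasibleScores G n).Nonempty := by
  obtain ⟨p, hp⟩ := exists_isCommutingOperator X Y A B
  exact ⟨_, hp.score_mem hn⟩

theorem feasibleScores_anti {m n : ℕ} (hm : 1 ≤ m) (hmn : m ≤ n) :
    feasibleScores G n ⊆ feasibleScores G m := fun v hv => by
  obtain ⟨-, L, hL, hv⟩ := mem_feasibleScores.1 hv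
  exact mem_feasibleScores.2 ⟨hm, L, hL.mono hmn, hv⟩

theorem bddAbove_feasibleScores (n : ℕ) : BddAbove (feasibleScores G n) := by
  refine ⟨∑ a : A, ∑ b : B, ∑ x, ∑ y, ‖(G.payoff a b x y : ℂ)‖, fun v hv => ?_⟩
  obtain ⟨hn, L, hL, hv⟩ := mem_feasibleScores.1 hv
  have h1 : v ≤ ‖functionalScore G L‖ := by
    rw [← hv, Complex.norm_real]
    exact le_abs_self v
  refine h1.trans ?_
  refine norm_sum_le_of_le _ fun a _ => norm_sum_le_of_le _ fun b _ => norm_sum_le_of_le _ fun x _ =>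
    norm_sum_le_of_le _ fun y _ => ?_
  rw [norm_mul]
  exact mul_le_of_le_one_right (norm_nonneg _)
    (hL.norm_apply_le (words_mono (by lia) (gen_mem_words _ hn _)))

theorem isGreatest_hierarchyValue [Nonempty X] [Nonempty A] {n : ℕ} (hn : 1 ≤ n) :
    IsGreatest (feasibleScores G n) (hierarchyValue G n) := by
  refine ⟨?_, fun v hv => le_csSup (bddAbove_feasibleScores n) hv⟩
  -- Attainment by compactness: functionals with scores tending to the supremum have a limit at the
  -- same level.
  obtain ⟨u, -, hu, hmem⟩ := exists_seq_tendsto_sSup (feasibleScores_nonempty (G := G) hn)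
    (bddAbove_feasibleScores n)
  choose _ L hL hv using fun k => mem_feasibleScores.1 (hmem k)
  obtain ⟨Λ, hΛ⟩ := exists_isLevel_limit (hyperfilter ℕ) (fun _ => n) (.of_forall hL)
  obtain ⟨hΛn, hlim⟩ := hΛ n (.of_forall fun _ => le_rfl)
  refine mem_feasibleScores.2 ⟨hn, Λ, hΛn, tendsto_nhds_unique ?_
    (tendsto_functionalScore G fun i => hlim _ (gen_mem_wordSpan_two_mul hn i))⟩
  simp only [← hv]
  exact (Complex.continuous_ofReal.tendsto _).comp (hu.mono_left Nat.hyperfilter_le_atTop)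

theorem bddAbove_scores [Nonempty A] :
    BddAbove (G.score '' {p : Correlation X Y A B | IsCommutingOperator p}) :=
  (bddAbove_feasibleScores 1).mono (by
    rintro _ ⟨p, hp, rfl⟩
    exact IsCommutingOperator.score_mem hp le_rfl)

theorem isLUB_commutingValue [Nonempty X] [Nonempty A] :
    IsLUB (G.score '' {p : Correlation X Y A B | IsCommutingOperator p}) G.commutingValue :=
  isLUB_csSup (Set.Nonempty.image _ (exists_isCommutingOperator X Y A B)) bddAbove_scores

theorem tendsto_hierarchyValue [Nonempty X] [Nonempty A] :
    Tendsto (hierarchyValue G) atTop (𝓝 G.commutingValue) := by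
  -- Along any ultrafilter finer than `atTop`, maximizers converge to a functional of all levels.
  -- Its table `p` is a commuting strategy whose score is the limit of the values, so the limit is
  -- at most the commuting value; each level's value is at least that value.
  refine (tendsto_iff_ultrafilter _ _ _).2 fun U hU => ?_
  have h1 : ∀ N, ∀ᶠ k in (U : Filter ℕ), N ≤ k := fun N => hU (eventually_ge_atTop N)
  have hex : ∀ n, ∃ L : AlgAB X Y A B →ₗ[ℂ] ℂ, 1 ≤ n → IsLevel n L ∧
      (hierarchyValue G n : ℂ) = functionalScore G L := fun n => by
    by_cases hn : 1 ≤ n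
    · obtain ⟨-, L, hL⟩ := mem_feasibleScores.1 (isGreatest_hierarchyValue (G := G) hn).1
      exact ⟨L, fun _ => hL⟩
    · exact ⟨0, fun h => absurd h hn⟩
  choose L hL using hex
  obtain ⟨Λ, hΛ⟩ := exists_isLevel_limit U id ((h1 1).mono fun k hk => (hL k hk).1)
  have hlim := tendsto_functionalScore G fun i =>
    (hΛ 1 (h1 1)).2 _ (gen_mem_wordSpan_two_mul (A := A) (X := X) le_rfl i)
  -- Taking real parts loses nothing, since `Λ` is nonnegative on the generators.
  let p : Correlation X Y A B := fun a b x y => (Λ (gen _ (a, b, x, y))).re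
  have hp : ∀ a b x y, (p a b x y : ℂ) = Λ (gen _ (a, b, x, y)) := fun a b x y =>
    Complex.ext rfl (Complex.nonneg_iff.1 ((hΛ 1 (h1 1)).1.apply_gen_nonneg le_rfl _)).2
  have hpc : IsCommutingOperator p := isCommutingOperator_of_isLevel (fun n => (hΛ n (h1 n)).1) hp
  rw [functionalScore_eq G hp] at hlim
  have hval : Tendsto (hierarchyValue G) U (𝓝 (G.score p)) := by
    have h2 := (Complex.continuous_re.tendsto _).comp hlim
    refine h2.congr' ?_
    filter_upwards [h1 1] with k hk
    rw [Function.comp_apply, ← (hL k hk).2, Complex.ofReal_re]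
  have hle : G.score p ≤ G.commutingValue := isLUB_commutingValue.1 ⟨p, hpc, rfl⟩
  have hge : G.commutingValue ≤ G.score p := by
    refine ge_of_tendsto hval ?_
    filter_upwards [h1 1] with k hk
    refine isLUB_commutingValue.2 ?_
    rintro _ ⟨p', hp', rfl⟩
    exact (isGreatest_hierarchyValue hk).2 (IsCommutingOperator.score_mem hp' hk)
  rwa [le_antisymm hge hle]

end Equivalence

end

end SeqNPA

/-! ### The main theorem -/

theorem mainTheorem6 {X Y A B : Type} [Fintype X] [Fintype Y] [Fintype A] [Fintype B]
    [Nonempty X] [Nonempty Y] [Nonempty A] [Nonempty B] (G : SeqNPA.NonlocalGame X Y A B) :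
    (∀ p : SeqNPA.Correlation X Y A B,
      [SeqNPA.IsSequentialONS p, SeqNPA.IsCommutingOperator p,
        SeqNPA.IsRealizedAtAllLevels p].TFAE) ∧
    (∀ n, 1 ≤ n → IsGreatest (SeqNPA.feasibleScores G n) (SeqNPA.hierarchyValue G n)) ∧
    IsLUB (G.score '' {p | SeqNPA.IsCommutingOperator p}) G.commutingValue ∧
    AntitoneOn (SeqNPA.hierarchyValue G) (Set.Ici 1) ∧
    Filter.Tendsto (SeqNPA.hierarchyValue G) Filter.atTop (nhds G.commutingValue) := by
  refine ⟨fun p => ?_, fun n hn => SeqNPA.isGreatest_hierarchyValue hn,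
    SeqNPA.isLUB_commutingValue, fun m hm n hn hmn => ?_, SeqNPA.tendsto_hierarchyValue⟩
  · tfae_have 1 → 2 := fun h => h.isCommutingOperator
    tfae_have 2 → 1 := fun h => by
      obtain ⟨D, _, φ, S, R, h⟩ := h.exists_rootStrategy
      exact h.isSequentialONS
    tfae_have 3 ↔ 2 := SeqNPA.isRealizedAtAllLevels_iff
    tfae_finish
  · exact (SeqNPA.isGreatest_hierarchyValue hm).2
      (SeqNPA.feasibleScores_anti hm hmn (SeqNPA.isGreatest_hierarchyValue hn).1)
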